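/- Let $m,N$ be positive integers, let $\hat\mu,\hat\xi_1,\dots,\hat\xi_N\in\mathbb R^m$ and $\rho,\epsilon\in\mathbb R$ be arbitrary, let $A\in\mathbb R^{N\times m}$ be the matrix with rows $(\hat\mu-\hat\xi_i)^\top$, let $e$ denote a vector of ones, and let $$\mathcal C=\{x\in\mathbb R^m:\ \hat\mu^\top x\ge\rho+\epsilon,\ e^\top x=1,\ x\ge 0\},$$ which is assumed to be nonempty, with Euclidean projection $\Pi_{\mathcal C}$ and indicator function $\chi_{\mathcal C}$. Let $\sigma_k,\gamma_k>0$ and $x^k\in\mathbb R^m$. For $u\in\mathbb R^N$ put $$\hat z(u)=x^k+\sigma_kA^\top u,\qquad \tilde z(u)=Ax^k-\epsilon e-\gamma_k\big(\tfrac1{2N}e+u\big),$$ and consider the dual subproblem of minimizing over $u\in\mathbb R^N$ the function $$\psi_k(u)=-E^{\sigma_k}_{\chi_{\mathcal C}}(\hat z(u))-\tfrac1{2\sigma_k}\|x^k\|^2+\tfrac1{2\sigma_k}\|\hat z(u)\|^2-\tfrac1{\gamma_k}E^1_{\frac{\gamma_k}{2N}\|\cdot\|_1}(\tilde z(u))-\tfrac1{2\gamma_k}\|Ax^k-\epsilon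 e\|^2+\tfrac1{2\gamma_k}\|\tilde z(u)\|^2-\epsilon(1+u^\top e),$$ where $E^t_f(x)=\min_y\{f(y)+\frac1{2t}\|y-x\|^2\}$. Write $\mathrm{Prox}_f(x)=\arg\min_y\{f(y)+\frac12\|y-x\|^2\}$. HS-Jacobian. Write $\mathcal C=\{x:\ b_i^\top x\ge\beta_i\ (1\le i\le m+1),\ e^\top x=1\}$, where the inequalities are $x_i\ge0$ $(1\le i\le m)$ and $\hat\mu^\top x\ge\rho+\epsilon$. For $z\in\mathbb R^m$, the set $\mathcal N_{\mathcal C}(z)$ consists of the matrices $I-G_K^\top(G_KG_K^\top)^{-1}G_K$, where $G_K$ has the rows $b_i^\top$ $(i\in K)$ and $e^\top$, and $K$ ranges over the index sets such that these rows are linearly independent, $b_i^\top\Pi_{\mathcal C}(z)=\beta_i$ for all $i\in K$, and there are $\lambda\in\mathbb R^{m+1}$, $\nu\in\mathbb R$ with $\lambda\ge0$, $\lambda_i=0$ for $i\notin K$, $\lambda_i(b_i^\top\Pi_{\mathcal C}(z)-\beta_i)=0$ for all $i$, and $\Pi_{\mathcal C}(z)-z=\sum_i\lambda_ib_i+\nu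 e$. SSN algorithm. Fix $\vartheta\in(0,\frac12)$, $\bar\tau\in(0,1]$, $\tilde\upsilon_1\in(1,\infty)$, $\tilde\upsilon_2,\bar\varrho,\varrho\in(0,1)$ and $u^0\in\mathbb R^N$. Given $u^j$, choose $N_j\in\mathcal N_{\mathcal C}(\hat z(u^j))$ and $U_j$ in the Clarke generalized Jacobian of $\mathrm{Prox}_{\frac{\gamma_k}{2N}\|\cdot\|_1}$ at $\tilde z(u^j)$, and put $\mathcal V_j=\sigma_kAN_jA^\top+\gamma_kU_j$, $\epsilon_j=\tilde\upsilon_1\min\{\tilde\upsilon_2,\|\nabla\psi_k(u^j)\|\}$. Solve $(\mathcal V_j+\epsilon_jI_N)d=-\nabla\psi_k(u^j)$ by a direct method (so that $d^j$ is an exact solution) or by the conjugate gradient method started at $0$ (so that $d^j$ is one of its iterates), such that $$\|(\mathcal V_j+\epsilon_jI_N)d^j+\nabla\psi_k(u^j)\|\le\min\big(\bar\varrho,\|\nabla\psi_k(u^j)\|^{1+\bar\tau}\big).$$ Let $\bar c_j$ be the smallest integer $\bar c\ge0$ with $\psi_k(u^j+\varrho^{\bar c}d^j)\le\psi_k(u^j)+\vartheta\varrho^{\bar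 c}\langle\nabla\psi_k(u^j),d^j\rangle$, and set $u^{j+1}=u^j+\varrho^{\bar c_j}d^j$. Theorem. Let $u^*$ be an accumulation point of an infinite sequence $\{u^j\}$ generated by the SSN algorithm. Assume that the constraint nondegeneracy condition $$A\,\mathrm{lin}\big(\mathscr T_{\mathcal C}(\hat x)\big)=\mathbb R^N$$ holds at $\hat x:=\Pi_{\mathcal C}(x^k+\sigma_kA^\top u^*)$, where $\mathscr T_{\mathcal C}(\hat x)$ is the tangent cone of $\mathcal C$ at $\hat x$ and $\mathrm{lin}(\mathscr T)=\mathscr T\cap(-\mathscr T)$. Then $u^*$ is the unique minimizer of $\psi_k$, the whole sequence $\{u^j\}$ converges to $u^*$, and the convergence is superlinear: $\|u^{j+1}-u^*\|=o(\|u^j-u^*\|)$ and $$\|u^{j+1}-u^*\|=\mathcal O\big(\|u^j-u^*\|^{1+\bar\tau}\big)\qquad(j\to\infty).$$ -/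

import Mathlib

open Filter Topology

noncomputable section

namespace SSN

/-! ### Convex-analytic notions

An extended-valued function `f : E → (-∞, +∞]` is represented by its effective domain `D` and its
real values on `D`.  In particular the indicator function of a set `C` is the pair `(C, 0)`. -/

section General

variable {E : Type*} [NormedAddCommGroup E] [InnerProductSpace ℝ E]

/-- The Moreau-Yosida regularization
`E_f^t(x) = min_y { f(y) + 1/(2t) * ‖y - x‖² }`, the minimum running over the domain `D` of `f`. -/
def moreauEnvelope (D : Set E) (f : E → ℝ) (t : ℝ) (x : E) : ℝ :=
  sInf ((fun y => f y + 1 / (2 * t) * ‖y - x‖ ^ 2) '' D)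

open Classical in
/-- The proximal mapping `Prox_f(x) = argmin_y { f(y) + 1/2 * ‖y - x‖² }`, the argmin running over
the domain `D` of `f` (the value is `0` if there is no minimizer, which does not happen for closed
proper convex functions on a Euclidean space; for these the minimizer is unique). -/
def prox (D : Set E) (f : E → ℝ) (x : E) : E :=
  if h : ∃ y ∈ D, IsMinOn (fun y => f y + 1 / 2 * ‖y - x‖ ^ 2) D y then h.choose else 0

/-- The metric projection onto `C`: the proximal mapping of the indicator function of `C`. -/
def proj (C : Set E) (x : E) : E := prox C (fun _ => 0) x

/-- The B-subdifferential of `F` at `x`: all limits of Fréchet derivatives of `F` along sequences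
of points of differentiability that converge to `x`. -/
def bSubdifferential (F : E → E) (x : E) : Set (E →L[ℝ] E) :=
  {L | ∃ v : ℕ → E, Tendsto v atTop (𝓝 x) ∧ (∀ n, DifferentiableAt ℝ F (v n)) ∧
    Tendsto (fun n => fderiv ℝ F (v n)) atTop (𝓝 L)}

/-- The Clarke generalized Jacobian: the convex hull of the B-subdifferential. -/
def clarkeJacobian (F : E → E) (x : E) : Set (E →L[ℝ] E) :=
  convexHull ℝ (bSubdifferential F x)

/-- The linearity space `lin (T) = T ∩ (-T)` of a cone `T`. -/
def linearitySpace (T : Set E) : Set E := {d | d ∈ T ∧ -d ∈ T}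

/-! ### The HS-Jacobian (Han-Sun) of the projection onto a polyhedron -/

/-- The polyhedron `{x | ⟪b i, x⟫ ≥ β i for all i, ⟪a k, x⟫ = α k for all k}`. -/
def polyhedron {ι κ : Type*} (b : ι → E) (β : ι → ℝ) (a : κ → E) (α : κ → ℝ) : Set E :=
  {x | (∀ i, β i ≤ inner ℝ (b i) x) ∧ ∀ k, inner ℝ (a k) x = α k}

/-- `(l, ν)` is a pair of Lagrange multipliers, for the inequalities and the equations, of the
problem `min { 1/2 * ‖x - z‖² | x ∈ polyhedron b β a α }` at its solution `Π(z)`. -/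
def IsProjMultiplier {ι κ : Type*} [Fintype ι] [Fintype κ]
    (b : ι → E) (β : ι → ℝ) (a : κ → E) (α : κ → ℝ) (z : E) (l : ι → ℝ) (ν : κ → ℝ) : Prop :=
  proj (polyhedron b β a α) z - z = ∑ i, l i • b i + ∑ k, ν k • a k ∧
  (∀ i, 0 ≤ l i) ∧
  ∀ i, l i * (inner ℝ (b i) (proj (polyhedron b β a α) z) - β i) = 0

/-- The Han-Sun index sets at `z`: sets `K` of active inequalities that contain the support of
some multiplier and for which the vectors `b i` (`i ∈ K`), `a k` are linearly independent. -/
def hsIndexSets {ι κ : Type*} [Fintype ι] [Fintype κ]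
    (b : ι → E) (β : ι → ℝ) (a : κ → E) (α : κ → ℝ) (z : E) : Set (Set ι) :=
  {K | (∃ l ν, IsProjMultiplier b β a α z l ν ∧ ∀ i, l i ≠ 0 → i ∈ K) ∧
    (∀ i ∈ K, inner ℝ (b i) (proj (polyhedron b β a α) z) = β i) ∧
    LinearIndependent ℝ (Sum.elim (fun i : K => b i) a)}

/-- The HS-Jacobian at `z` of the projection onto the polyhedron: all matrices
`I - Gᵀ (G Gᵀ)⁻¹ G`, where `G` has the (linearly independent) rows `b i` (`i ∈ K`) and `a k`, and
`K` is a Han-Sun index set.  This matrix is the orthogonal projector onto the orthogonal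
complement of the span of the rows of `G`. -/
def hsJacobian {ι κ : Type*} [Fintype ι] [Fintype κ] [FiniteDimensional ℝ E]
    (b : ι → E) (β : ι → ℝ) (a : κ → E) (α : κ → ℝ) (z : E) : Set (E →L[ℝ] E) :=
  {L | ∃ K ∈ hsIndexSets b β a α z,
    L = (Submodule.span ℝ (b '' K ∪ Set.range a))ᗮ.starProjection}

/-! ### The conjugate gradient method -/

/-- State of the conjugate gradient method: iterate, residual, search direction. -/
structure CGState (E : Type*) where
  x : E
  r : E
  p : E

/-- One step of the conjugate gradient method for the system with operator `M`.  Once the residual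
is zero, the step leaves the iterate unchanged, because `0 / 0 = 0`. -/
def cgStep (M : E →L[ℝ] E) (s : CGState E) : CGState E :=
  let a : ℝ := inner ℝ s.r s.r / inner ℝ s.p (M s.p)
  let r' : E := s.r - a • M s.p
  { x := s.x + a • s.p
    r := r'
    p := r' + (inner ℝ r' r' / inner ℝ s.r s.r : ℝ) • s.p }

/-- The `n`-th iterate of the conjugate gradient method for `M d = c`, started at `d = 0`. -/
def cgIterate (M : E →L[ℝ] E) (c : E) (n : ℕ) : E := ((cgStep M)^[n] ⟨0, c, c⟩).x

end General

/-! ### The dual subproblem -/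

/-- The vector of all ones. -/
def ones (n : ℕ) : EuclideanSpace ℝ (Fin n) := WithLp.toLp 2 fun _ => 1

/-- The `ℓ₁`-norm. -/
def l1norm {n : ℕ} (y : EuclideanSpace ℝ (Fin n)) : ℝ := ∑ i, |y i|

/-- The data of one dual subproblem: vectors `ξ̂₁, …, ξ̂_N, μ̂ ∈ ℝᵐ`, numbers `ρ, ε`, step parameters
`σ_k, γ_k > 0` and the current point `xᵏ ∈ ℝᵐ`. -/
structure Subproblem (m N : ℕ) where
  ξ : Fin N → EuclideanSpace ℝ (Fin m)
  μ : EuclideanSpace ℝ (Fin m)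
  ρ : ℝ
  ε : ℝ
  σ : ℝ
  γ : ℝ
  xk : EuclideanSpace ℝ (Fin m)
  σ_pos : 0 < σ
  γ_pos : 0 < γ

namespace Subproblem

variable {m N : ℕ} (P : Subproblem m N)

/-- `C = {x | μ̂ᵀ x ≥ ρ + ε, eᵀ x = 1, x ≥ 0}`. -/
def C : Set (EuclideanSpace ℝ (Fin m)) :=
  {x | P.ρ + P.ε ≤ inner ℝ P.μ x ∧ ∑ i, x i = 1 ∧ ∀ i, 0 ≤ x i}

/-- Normals of the inequalities `x_i ≥ 0` and `μ̂ᵀ x ≥ ρ + ε` that describe `C`. -/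
def ineqNormal : Fin m ⊕ Unit → EuclideanSpace ℝ (Fin m) :=
  Sum.elim (fun i => EuclideanSpace.single i 1) (fun _ => P.μ)

/-- Right-hand sides of the inequalities that describe `C`. -/
def ineqRhs : Fin m ⊕ Unit → ℝ := Sum.elim (fun _ => 0) (fun _ => P.ρ + P.ε)

theorem C_eq_polyhedron :
    P.C = polyhedron P.ineqNormal P.ineqRhs (fun _ : Unit => ones m) (fun _ => 1) := by
  ext x
  simp [C, polyhedron, ineqNormal, ineqRhs, ones, PiLp.inner_apply]
  tauto

/-- The HS-Jacobian `𝒩_C(z)` of the projection onto `C`, with the above description of `C`. -/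
def hsJacobianC (z : EuclideanSpace ℝ (Fin m)) :
    Set (EuclideanSpace ℝ (Fin m) →L[ℝ] EuclideanSpace ℝ (Fin m)) :=
  hsJacobian P.ineqNormal P.ineqRhs (fun _ : Unit => ones m) (fun _ => 1) z

/-- The matrix `A ∈ ℝ^{N × m}` with rows `(μ̂ - ξ̂ᵢ)ᵀ`. -/
def matA : Matrix (Fin N) (Fin m) ℝ := Matrix.of fun i j => P.μ j - P.ξ i j

/-- `A` as a continuous linear map. -/
def A : EuclideanSpace ℝ (Fin m) →L[ℝ] EuclideanSpace ℝ (Fin N) :=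
  LinearMap.toContinuousLinearMap (Matrix.toEuclideanLin P.matA)

/-- `Aᵀ` as a continuous linear map. -/
def At : EuclideanSpace ℝ (Fin N) →L[ℝ] EuclideanSpace ℝ (Fin m) :=
  LinearMap.toContinuousLinearMap (Matrix.toEuclideanLin P.matA.transpose)

/-- `ẑ(u) = xᵏ + σ_k Aᵀ u`. -/
def zHat (u : EuclideanSpace ℝ (Fin N)) : EuclideanSpace ℝ (Fin m) := P.xk + P.σ • P.At u

/-- `z̃(u) = A xᵏ - ε e - γ_k (e / (2N) + u)`. -/
def zTilde (u : EuclideanSpace ℝ (Fin N)) : EuclideanSpace ℝ (Fin N) :=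
  P.A P.xk - P.ε • ones N - P.γ • ((1 / (2 * (N : ℝ))) • ones N + u)

/-- The function `γ_k / (2N) * ‖·‖₁` on `ℝᴺ`. -/
def scaledL1 (y : EuclideanSpace ℝ (Fin N)) : ℝ := P.γ / (2 * (N : ℝ)) * l1norm y

/-- The objective function `ψ_k` of the dual subproblem (to be minimized). -/
def ψ (u : EuclideanSpace ℝ (Fin N)) : ℝ :=
  -moreauEnvelope P.C (fun _ => 0) P.σ (P.zHat u) - 1 / (2 * P.σ) * ‖P.xk‖ ^ 2
    + 1 / (2 * P.σ) * ‖P.zHat u‖ ^ 2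
    - 1 / P.γ * moreauEnvelope Set.univ P.scaledL1 1 (P.zTilde u)
    - 1 / (2 * P.γ) * ‖P.A P.xk - P.ε • ones N‖ ^ 2
    + 1 / (2 * P.γ) * ‖P.zTilde u‖ ^ 2
    - P.ε * (1 + inner ℝ u (ones N))

/-- The constraint nondegeneracy condition at `x`: `A lin(T_C(x)) = ℝᴺ`, where `T_C(x)` is the
tangent cone of `C` at `x`. -/
def ConstraintNondegenerate (x : EuclideanSpace ℝ (Fin m)) : Prop :=
  P.A '' linearitySpace (posTangentConeAt P.C x) = Set.univ

end Subproblem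

/-! ### The semismooth Newton algorithm -/

/-- The parameters of the semismooth Newton algorithm. -/
structure Params where
  ϑ : ℝ
  τ : ℝ
  υ₁ : ℝ
  υ₂ : ℝ
  ϱbar : ℝ
  ϱ : ℝ
  ϑ_mem : ϑ ∈ Set.Ioo (0 : ℝ) (1 / 2)
  τ_mem : τ ∈ Set.Ioc (0 : ℝ) 1
  one_lt_υ₁ : 1 < υ₁
  υ₂_mem : υ₂ ∈ Set.Ioo (0 : ℝ) 1
  ϱbar_mem : ϱbar ∈ Set.Ioo (0 : ℝ) 1
  ϱ_mem : ϱ ∈ Set.Ioo (0 : ℝ) 1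

/-- `d` is an admissible approximate Newton direction at `u`: for some `V = σ A N Aᵀ + γ U` with
`N ∈ 𝒩_C(ẑ(u))` and `U ∈ ∂Prox(z̃(u))` and for the regularization `δ = υ₁ min {υ₂, ‖∇ψ(u)‖}`, it
is computed from `(V + δ I) d = -∇ψ(u)` by a direct method (exact solution) or by the conjugate
gradient method (some iterate), with residual at most `min {ϱbar, ‖∇ψ(u)‖^(1+τ)}`. -/
def IsNewtonDirection {m N : ℕ} (P : Subproblem m N) (Q : Params)
    (u d : EuclideanSpace ℝ (Fin N)) : Prop :=
  ∃ H ∈ P.hsJacobianC (P.zHat u),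
  ∃ U ∈ clarkeJacobian (prox Set.univ P.scaledL1) (P.zTilde u),
  ∃ M : EuclideanSpace ℝ (Fin N) →L[ℝ] EuclideanSpace ℝ (Fin N),
    M = P.σ • (P.A ∘L H ∘L P.At) + P.γ • U
      + (Q.υ₁ * min Q.υ₂ ‖gradient P.ψ u‖) •
          ContinuousLinearMap.id ℝ (EuclideanSpace ℝ (Fin N)) ∧
    (M d = -gradient P.ψ u ∨ ∃ n, d = cgIterate M (-gradient P.ψ u) n) ∧
    ‖M d + gradient P.ψ u‖ ≤ min Q.ϱbar (‖gradient P.ψ u‖ ^ (1 + Q.τ))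

/-- `c` is the smallest nonnegative integer that satisfies the Armijo condition
`ψ(u + ϱ^c d) ≤ ψ(u) + ϑ ϱ^c ⟪∇ψ(u), d⟫`. -/
def IsArmijoExponent {m N : ℕ} (P : Subproblem m N) (Q : Params)
    (u d : EuclideanSpace ℝ (Fin N)) (c : ℕ) : Prop :=
  IsLeast {c : ℕ | P.ψ (u + Q.ϱ ^ c • d) ≤
    P.ψ u + Q.ϑ * Q.ϱ ^ c * inner ℝ (gradient P.ψ u) d} c

/-- `u` is an infinite sequence generated by the semismooth Newton algorithm. -/
def IsSSNSequence {m N : ℕ} (P : Subproblem m N) (Q : Params)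
    (u : ℕ → EuclideanSpace ℝ (Fin N)) : Prop :=
  ∀ j, ∃ d, IsNewtonDirection P Q (u j) d ∧
    ∃ c, IsArmijoExponent P Q (u j) d c ∧ u (j + 1) = u j + Q.ϱ ^ c • d

end SSN

end

/-!
Write `F(u) = A Π_C(ẑ(u)) - Prox(z̃(u)) - ε e`. Each of the two Moreau envelopes in `ψ` enters as
`1/2 * ‖·‖²` minus an envelope, which is a convex function that has the proximal point as a
subgradient (`IsProxPoint.subgradient`). Since proximal mappings are nonexpansive, `ψ` is convex and
`F` is its Lipschitz continuous gradient.

Both proximal mappings are piecewise affine, and this replaces semismoothness by exact identities: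
for `u` near a point `x`, `F` is affine on the segment from `x` to `u`, with every admissible
generalized Hessian `V = σ A H Aᵀ + γ U` at `u` as its linear part. For soft thresholding this is
checked coordinatewise (`eventually_prox_l1norm_segment`). For the projection onto `C` the point is
that a Han-Sun index set at points arbitrarily near `z₀` is one at `z₀`, because a cone generated by
linearly independent vectors is closed (`eventually_hsIndexSets_subset`); a common index set then
makes the projection affine on the segment (`proj_polyhedron_segment`).

The range of such an `H` contains the linearity space of the tangent cone of `C` at `Π_C(ẑ(x))`.
As `A` maps that space onto `ℝᴺ`, the matrices `V` are uniformly positive definite near `x`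
(`exists_pos_le_norm_starProjection`).

A conjugate gradient iterate is orthogonal to its residual (`inner_residual_cgIterate`), and so is
an exact solution. Hence `⟪∇ψ, d⟫ = -⟪M d, d⟫`, with `M` the regularized matrix, and near an
accumulation point `x` the step sizes are bounded below. If `∇ψ(x)` were nonzero, `ψ` would decrease
infinitely often by a fixed amount, although `ψ(x)` is a lower bound along the sequence
(`IsNewtonModel.gradient_eq_zero`). So `∇ψ(x) = 0`, and near `x` the error `h + d` after a full step
from `x + h` satisfies `M (h + d) = δ h + residual`, with a regularization `δ` of order `‖h‖`; it is
therefore of order `‖h‖^(1 + τ)`. As `ψ(x + h) - ψ(x)` equals `1/2 * ⟪∇ψ(x + h), h⟫` exactly and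
`ϑ < 1/2`, the line search accepts the full step (`IsNewtonModel.eventually_full_step`), so that
from some index on the iterates contract towards `x`.

Uniqueness of the minimizer is global: monotonicity forces `Π_C(ẑ)` to agree at two critical points,
and nondegeneracy then identifies the points (`Subproblem.eq_of_grad_eq_zero`).
-/

noncomputable section

namespace SSN

/-! ### Proximal points -/

section Prox

variable {E : Type*} [NormedAddCommGroup E] [InnerProductSpace ℝ E]

/-- `y` solves the variational inequality that characterizes the minimizer over `D` of
`f + 1/2 * ‖· - x‖²`: the vector `x - y` is a subgradient at `y` of `f` restricted to `D`. -/
def IsProxPoint (D : Set E) (f : E → ℝ) (x y : E) : Prop :=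
  y ∈ D ∧ ∀ w ∈ D, f y + inner ℝ (x - y) (w - y) ≤ f w

variable {D : Set E} {f : E → ℝ} {x x' y y' w : E}

theorem IsProxPoint.add_half_sq_le (h : IsProxPoint D f x y) (hw : w ∈ D) :
    f y + 1 / 2 * ‖y - x‖ ^ 2 + 1 / 2 * ‖w - y‖ ^ 2 ≤ f w + 1 / 2 * ‖w - x‖ ^ 2 := by
  have h1 := h.2 w hw
  have h2 : ‖w - x‖ ^ 2 = ‖w - y‖ ^ 2 - 2 * inner ℝ (w - y) (x - y) + ‖x - y‖ ^ 2 := by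
    rw [← norm_sub_sq_real]; congr 2; abel
  rw [h2, norm_sub_rev y x, real_inner_comm]
  linarith

theorem IsProxPoint.prox_eq (h : IsProxPoint D f x y) : prox D f x = y := by
  have hex : ∃ y ∈ D, IsMinOn (fun y => f y + 1 / 2 * ‖y - x‖ ^ 2) D y := by
    refine ⟨y, h.1, fun w hw => ?_⟩
    have := h.add_half_sq_le hw
    have := sq_nonneg ‖w - y‖
    simp only [Set.mem_ofPred_eq]
    linarith
  have hp : prox D f x = hex.choose := dif_pos hex
  obtain ⟨hD, hmin⟩ := hex.choose_spec
  rw [← hp] at hD hmin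
  have h1 := h.add_half_sq_le hD
  have h2 := hmin h.1
  simp only [Set.mem_ofPred_eq] at h2
  have h3 : ‖prox D f x - y‖ ^ 2 ≤ 0 := by linarith
  have h4 : ‖prox D f x - y‖ = 0 := by
    have := sq_nonneg ‖prox D f x - y‖
    exact pow_eq_zero_iff two_ne_zero |>.1 (le_antisymm h3 this)
  exact sub_eq_zero.1 (norm_eq_zero.1 h4)

theorem IsProxPoint.moreauEnvelope_eq {t : ℝ} (ht : 0 < t)
    (h : IsProxPoint D (fun z => t * f z) x y) :
    moreauEnvelope D f t x = f y + 1 / (2 * t) * ‖y - x‖ ^ 2 := by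
  refine IsLeast.csInf_eq ⟨⟨y, h.1, rfl⟩, ?_⟩
  rintro _ ⟨w, hw, rfl⟩
  have h1 := h.add_half_sq_le hw
  have h2 := sq_nonneg ‖w - y‖
  have h3 : t * (f y + 1 / (2 * t) * ‖y - x‖ ^ 2) ≤ t * (f w + 1 / (2 * t) * ‖w - x‖ ^ 2) := by
    have e : ∀ a b : ℝ, t * (a + 1 / (2 * t) * b) = t * a + 1 / 2 * b := by
      intro a b; field_simp
    rw [e, e]; linarith
  exact le_of_mul_le_mul_left h3 ht

/-- The function `x ↦ 1/2 * ‖x‖² - E(x)`, with `E` the Moreau envelope, is the conjugate of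
`f + 1/2 * ‖·‖²`; the proximal point `y` is a subgradient of it. -/
theorem IsProxPoint.subgradient (h : IsProxPoint D f x y) (h' : IsProxPoint D f x' y') :
    1 / 2 * ‖x‖ ^ 2 - (f y + 1 / 2 * ‖y - x‖ ^ 2) + inner ℝ y (x' - x) ≤
      1 / 2 * ‖x'‖ ^ 2 - (f y' + 1 / 2 * ‖y' - x'‖ ^ 2) := by
  have h1 := h'.add_half_sq_le h.1
  have h2 := sq_nonneg ‖y - y'‖
  rw [norm_sub_sq_real y x'] at h1
  rw [norm_sub_sq_real y x, inner_sub_right]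
  linarith

theorem IsProxPoint.norm_sub_sq_le (h : IsProxPoint D f x y) (h' : IsProxPoint D f x' y') :
    ‖y - y'‖ ^ 2 ≤ inner ℝ (y - y') (x - x') := by
  have h1 := h.2 y' h'.1
  have h2 := h'.2 y h.1
  have e : inner ℝ (y - y') (x - x')
      = -inner ℝ (x - y) (y' - y) - inner ℝ (x' - y') (y - y') + ‖y - y'‖ ^ 2 := by
    rw [← real_inner_self_eq_norm_sq]
    simp only [inner_sub_right, inner_sub_left]
    rw [real_inner_comm x y, real_inner_comm x y', real_inner_comm x' y, real_inner_comm x' y']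
    ring
  linarith

theorem IsProxPoint.norm_sub_le (h : IsProxPoint D f x y) (h' : IsProxPoint D f x' y') :
    ‖y - y'‖ ≤ ‖x - x'‖ := by
  have h1 := h.norm_sub_sq_le h'
  have h2 := real_inner_le_norm (y - y') (x - x')
  by_contra! hlt
  nlinarith [norm_nonneg (x - x'), norm_nonneg (y - y')]

theorem isProxPoint_proj [CompleteSpace E] {C : Set E} (hne : C.Nonempty) (hcl : IsClosed C)
    (hco : Convex ℝ C) (x : E) : IsProxPoint C (fun _ => 0) x (proj C x) := by
  obtain ⟨y, hy, hmin⟩ := exists_norm_eq_iInf_of_complete_convex hne hcl.isComplete hco x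
  rw [norm_eq_iInf_iff_real_inner_le_zero hco hy] at hmin
  have h : IsProxPoint C (fun _ => (0 : ℝ)) x y := ⟨hy, fun w hw => by simpa using hmin w hw⟩
  rw [proj, h.prox_eq]
  exact h

end Prox

/-! ### Soft thresholding -/

/-- Soft thresholding with threshold `t`, the proximal mapping of `t * |·|` on `ℝ`. -/
def soft (t x : ℝ) : ℝ := x - max (-t) (min x t)

section Soft

variable {t x : ℝ}

theorem soft_of_le (h : 0 ≤ t) (hx : t ≤ x) : soft t x = x - t := by
  rw [soft, min_eq_right hx, max_eq_right (by linarith)]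

theorem soft_of_le_neg (h : 0 ≤ t) (hx : x ≤ -t) : soft t x = x + t := by
  rw [soft, min_eq_left (by linarith), max_eq_left hx, sub_neg_eq_add]

theorem soft_of_mem (h₁ : -t ≤ x) (h₂ : x ≤ t) : soft t x = 0 := by
  rw [soft, min_eq_left h₂, max_eq_right h₁, sub_self]

theorem soft_subgradient (ht : 0 ≤ t) (x w : ℝ) :
    t * |soft t x| + (x - soft t x) * (w - soft t x) ≤ t * |w| := by
  have hw : ∀ c, |c| ≤ t → c * w ≤ t * |w| := fun c hc =>
    (le_abs_self _).trans (by rw [abs_mul]; gcongr)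
  rcases le_total t x with h | h
  · rw [soft_of_le ht h, abs_of_nonneg (by linarith)]
    have := hw t (by rw [abs_of_nonneg ht])
    nlinarith
  rcases le_total x (-t) with h' | h'
  · rw [soft_of_le_neg ht h', abs_of_nonpos (by linarith)]
    have := hw (-t) (by rw [abs_neg, abs_of_nonneg ht])
    nlinarith
  · rw [soft_of_mem h' h]
    have := hw x (abs_le.2 ⟨h', h⟩)
    simpa using this

theorem soft_monotone (ht : 0 ≤ t) : Monotone (soft t) := by
  intro x y hxy
  rcases le_total t x with h | h <;> rcases le_total x (-t) with h1 | h1 <;>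
  rcases le_total t y with h2 | h2 <;> rcases le_total y (-t) with h3 | h3 <;>
  simp only [soft_of_le ht, soft_of_le_neg ht, soft_of_mem, h, h1, h2, h3] <;> linarith

theorem sub_soft_monotone : Monotone (fun x => x - soft t x) := by
  intro x y hxy
  simp only [soft, sub_sub_cancel]
  gcongr

/-- `soft t` is affine with slope `D` between `x₀` and each nearby `x`, where `D` is the derivative
at `x` if `|x| ≠ t`. If `|x| = t`, then `D` is arbitrary: nearby kinks `x` coincide with `x₀`. -/
theorem eventually_soft_segment (ht : 0 < t) (x₀ : ℝ) :
    ∀ᶠ x in 𝓝 x₀, ∀ D : ℝ, (t < |x| → D = 1) → (|x| < t → D = 0) →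
      ∀ s ∈ Set.Icc (0 : ℝ) 1, soft t (x₀ + s * (x - x₀)) = soft t x₀ + s * (D * (x - x₀)) := by
  -- On each closed linear piece the claim holds as soon as `D` is the slope of that piece.
  have up : ∀ x, t ≤ x₀ → t ≤ x → ∀ s ∈ Set.Icc (0 : ℝ) 1,
      soft t (x₀ + s * (x - x₀)) = soft t x₀ + s * (1 * (x - x₀)) := by
    rintro x h₀ h s ⟨hs, hs'⟩
    rw [soft_of_le ht.le h₀, soft_of_le ht.le (by nlinarith)]; ring
  have down : ∀ x, x₀ ≤ -t → x ≤ -t → ∀ s ∈ Set.Icc (0 : ℝ) 1,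
      soft t (x₀ + s * (x - x₀)) = soft t x₀ + s * (1 * (x - x₀)) := by
    rintro x h₀ h s ⟨hs, hs'⟩
    rw [soft_of_le_neg ht.le h₀, soft_of_le_neg ht.le (by nlinarith)]; ring
  have mid : ∀ x, |x₀| ≤ t → |x| ≤ t → ∀ s ∈ Set.Icc (0 : ℝ) 1,
      soft t (x₀ + s * (x - x₀)) = soft t x₀ + s * (0 * (x - x₀)) := by
    rintro x h₀ h s ⟨hs, hs'⟩
    rw [abs_le] at h₀ h
    rw [soft_of_mem h₀.1 h₀.2, soft_of_mem (by nlinarith) (by nlinarith)]; ring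
  have trivial_case : ∀ x D s : ℝ, soft t (x + s * (x - x)) = soft t x + s * (D * (x - x)) := by
    intro x D s; simp
  rcases lt_trichotomy t |x₀| with h | h | h
  · rcases lt_abs.1 h with h' | h'
    · filter_upwards [lt_mem_nhds h'] with x hx D h1 _
      rw [h1 (hx.trans_le (le_abs_self x))]
      exact up x h'.le hx.le
    · have h'' : x₀ < -t := by linarith
      filter_upwards [gt_mem_nhds h''] with x hx D h1 _
      rw [h1 (lt_abs.2 (Or.inr (by linarith)))]
      exact down x h''.le hx.le
  · rcases abs_choice x₀ with h' | h'
    · have h₀ : x₀ = t := by linarith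
      filter_upwards [lt_mem_nhds (show -t < x₀ by linarith)] with x hx D h1 h2
      rcases lt_trichotomy x t with h3 | h3 | h3
      · have hx' : |x| < t := abs_lt.2 ⟨hx, h3⟩
        rw [h2 hx']
        exact mid x h.ge hx'.le
      · obtain rfl : x = x₀ := h3.trans h₀.symm
        exact fun s _ => trivial_case x D s
      · rw [h1 (lt_abs.2 (Or.inl h3))]
        exact up x h₀.ge h3.le
    · have h₀ : x₀ = -t := by linarith
      filter_upwards [gt_mem_nhds (show x₀ < t by linarith)] with x hx D h1 h2
      rcases lt_trichotomy x (-t) with h3 | h3 | h3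
      · rw [h1 (lt_abs.2 (Or.inr (by linarith)))]
        exact down x h₀.le h3.le
      · obtain rfl : x = x₀ := h3.trans h₀.symm
        exact fun s _ => trivial_case x D s
      · have hx' : |x| < t := abs_lt.2 ⟨h3, hx⟩
        rw [h2 hx']
        exact mid x h.ge hx'.le
  · filter_upwards [continuous_abs.continuousAt.eventually_lt_const h] with x hx D _ h2
    rw [h2 hx]
    exact mid x h.le hx.le

end Soft

section SoftVec

variable {n : ℕ} {t : ℝ}

theorem isProxPoint_l1norm (ht : 0 ≤ t) (x : EuclideanSpace ℝ (Fin n)) :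
    IsProxPoint Set.univ (fun y => t * l1norm y) x (WithLp.toLp 2 fun i => soft t (x i)) := by
  refine ⟨Set.mem_univ _, fun w _ => ?_⟩
  simp only [l1norm, PiLp.inner_apply, Finset.mul_sum, ← Finset.sum_add_distrib]
  refine Finset.sum_le_sum fun i _ => ?_
  have := soft_subgradient ht (x i) (w i)
  simpa [mul_comm] using this

theorem prox_l1norm (ht : 0 ≤ t) (x : EuclideanSpace ℝ (Fin n)) :
    prox Set.univ (fun y => t * l1norm y) x = WithLp.toLp 2 fun i => soft t (x i) :=
  (isProxPoint_l1norm ht x).prox_eq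

/-- `L` is a diagonal matrix whose diagonal entries belong to the Clarke subdifferentials of
`soft t` at the coordinates of `y`. -/
def IsSoftJacobian (t : ℝ) (y : EuclideanSpace ℝ (Fin n))
    (L : EuclideanSpace ℝ (Fin n) →L[ℝ] EuclideanSpace ℝ (Fin n)) : Prop :=
  ∀ i, (∀ w, L w i = w i * L (EuclideanSpace.single i 1) i) ∧
    L (EuclideanSpace.single i 1) i ∈ Set.Icc (0 : ℝ) 1 ∧
    (t < |y i| → L (EuclideanSpace.single i 1) i = 1) ∧
    (|y i| < t → L (EuclideanSpace.single i 1) i = 0)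

theorem convex_isSoftJacobian (y : EuclideanSpace ℝ (Fin n)) :
    Convex ℝ {L | IsSoftJacobian t y L} := by
  intro L hL L' hL' a b ha hb hab i
  obtain ⟨h1, h2, h3, h4⟩ := hL i
  obtain ⟨h1', h2', h3', h4'⟩ := hL' i
  refine ⟨fun w => ?_, ?_, fun h => ?_, fun h => ?_⟩
  · simp only [add_apply, smul_apply, PiLp.add_apply,
      PiLp.smul_apply, smul_eq_mul]
    rw [h1 w, h1' w]; ring
  · exact (convex_Icc (0 : ℝ) 1) h2 h2' ha hb hab
  · simp [h3 h, h3' h, hab]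
  · simp [h4 h, h4' h]

theorem isSoftJacobian_fderiv (ht : 0 ≤ t) {v : EuclideanSpace ℝ (Fin n)}
    (hv : DifferentiableAt ℝ (prox Set.univ fun y => t * l1norm y) v) :
    IsSoftJacobian t v (fderiv ℝ (prox Set.univ fun y => t * l1norm y) v) := by
  intro i
  set L := fderiv ℝ (prox Set.univ fun y => t * l1norm y) v with hL
  have key : ∀ w : EuclideanSpace ℝ (Fin n),
      HasDerivAt (fun s : ℝ => soft t (v i + s * w i)) (L w i) 0 := by
    intro w
    have h1 : HasDerivAt (fun s : ℝ => v + s • w) w 0 := by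
      simpa using ((hasDerivAt_id (0 : ℝ)).smul_const w).const_add v
    have h2 : HasFDerivAt (prox Set.univ fun y => t * l1norm y) L (v + (0 : ℝ) • w) := by
      simpa using hv.hasFDerivAt
    have h3 := h2.comp_hasDerivAt (0 : ℝ) h1
    have h4 := (EuclideanSpace.proj (𝕜 := ℝ) i).hasFDerivAt.comp_hasDerivAt (0 : ℝ) h3
    have e : (fun s : ℝ => soft t (v i + s * w i)) =
        (EuclideanSpace.proj (𝕜 := ℝ) i) ∘ (prox Set.univ fun y => t * l1norm y) ∘
          fun s : ℝ => v + s • w := by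
      funext s
      simp [prox_l1norm ht]
    rw [e]
    exact h4
  have hval := key (EuclideanSpace.single i 1)
  simp only [PiLp.single_apply, if_true, mul_one] at hval
  refine ⟨fun w => ?_, ⟨?_, ?_⟩, fun h => ?_, fun h => ?_⟩
  · have h0 := key (w - w i • EuclideanSpace.single i 1)
    have hz : (w - w i • EuclideanSpace.single i (1 : ℝ)) i = 0 := by simp
    rw [hz] at h0
    have := h0.unique (by simpa using hasDerivAt_const (0 : ℝ) (soft t (v i)))
    rw [map_sub, map_smul] at this
    simpa [sub_eq_zero] using this
  · rw [← hval.deriv]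
    exact Monotone.deriv_nonneg (fun a b hab => soft_monotone ht (by linarith))
  · have h1 := (((hasDerivAt_id (0 : ℝ)).const_add (v i)).sub hval)
    have h2 : 0 ≤ 1 - L (EuclideanSpace.single i 1) i := by
      rw [← h1.deriv]
      exact Monotone.deriv_nonneg
        (fun a b hab => sub_soft_monotone (t := t) (show v i + a ≤ v i + b by linarith))
    linarith
  · rcases lt_abs.1 h with h' | h'
    · refine hval.unique ((((hasDerivAt_id (0 : ℝ)).const_add (v i)).sub_const
        t).congr_of_eventuallyEq ?_)
      filter_upwards [lt_mem_nhds (show t - v i < 0 by linarith)] with s hs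
      exact soft_of_le ht (by linarith)
    · refine hval.unique ((((hasDerivAt_id (0 : ℝ)).const_add (v i)).add_const
        t).congr_of_eventuallyEq ?_)
      filter_upwards [gt_mem_nhds (show 0 < -t - v i by linarith)] with s hs
      exact soft_of_le_neg ht (by linarith)
  · rw [abs_lt] at h
    refine hval.unique ((hasDerivAt_const (0 : ℝ) (0 : ℝ)).congr_of_eventuallyEq ?_)
    filter_upwards [lt_mem_nhds (show -t - v i < 0 by linarith),
      gt_mem_nhds (show 0 < t - v i by linarith)] with s hs hs'
    exact soft_of_mem (by linarith) (by linarith)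

theorem isSoftJacobian_of_mem_clarkeJacobian (ht : 0 ≤ t) {y : EuclideanSpace ℝ (Fin n)}
    {L : EuclideanSpace ℝ (Fin n) →L[ℝ] EuclideanSpace ℝ (Fin n)}
    (hL : L ∈ clarkeJacobian (prox Set.univ fun y => t * l1norm y) y) : IsSoftJacobian t y L := by
  refine convexHull_min ?_ (convex_isSoftJacobian y) hL
  rintro L ⟨v, hv, hd, hlim⟩ i
  have hJ := fun k => isSoftJacobian_fderiv ht (hd k) i
  have hap : ∀ w, Tendsto (fun k => fderiv ℝ (prox Set.univ fun y => t * l1norm y) (v k) w i)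
      atTop (𝓝 (L w i)) := fun w =>
    ((EuclideanSpace.proj (𝕜 := ℝ) i).continuous.tendsto (L w)).comp
      (((ContinuousLinearMap.apply ℝ _ w).continuous.tendsto L).comp hlim)
  have habs : Tendsto (fun k => |v k i|) atTop (𝓝 |y i|) :=
    (((EuclideanSpace.proj (𝕜 := ℝ) i).continuous.tendsto y).comp hv).abs
  refine ⟨fun w => ?_, ?_, fun h => ?_, fun h => ?_⟩
  · refine tendsto_nhds_unique (hap w) ?_
    simp_rw [fun k => (hJ k).1 w]
    exact (hap _).const_mul _
  · exact isClosed_Icc.mem_of_tendsto (hap _) (Eventually.of_forall fun k => (hJ k).2.1)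
  · refine tendsto_nhds_unique_of_eventuallyEq (hap _) (tendsto_const_nhds (x := (1 : ℝ))) ?_
    filter_upwards [habs.eventually_const_lt h] with k hk using (hJ k).2.2.1 hk
  · refine tendsto_nhds_unique_of_eventuallyEq (hap _) (tendsto_const_nhds (x := (0 : ℝ))) ?_
    filter_upwards [habs.eventually_lt_const h] with k hk using (hJ k).2.2.2 hk

theorem IsSoftJacobian.inner_comm {y : EuclideanSpace ℝ (Fin n)}
    {L : EuclideanSpace ℝ (Fin n) →L[ℝ] EuclideanSpace ℝ (Fin n)} (hL : IsSoftJacobian t y L)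
    (v w : EuclideanSpace ℝ (Fin n)) : inner ℝ (L v) w = inner ℝ v (L w) := by
  simp only [PiLp.inner_apply]
  refine Finset.sum_congr rfl fun i _ => ?_
  rw [(hL i).1 v, (hL i).1 w]
  simp; ring

theorem IsSoftJacobian.inner_nonneg {y : EuclideanSpace ℝ (Fin n)}
    {L : EuclideanSpace ℝ (Fin n) →L[ℝ] EuclideanSpace ℝ (Fin n)} (hL : IsSoftJacobian t y L)
    (w : EuclideanSpace ℝ (Fin n)) : 0 ≤ inner ℝ (L w) w := by
  simp only [PiLp.inner_apply]
  refine Finset.sum_nonneg fun i _ => ?_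
  rw [(hL i).1 w]
  have := mul_nonneg (hL i).2.1.1 (mul_self_nonneg (w i))
  simp; linarith

theorem IsSoftJacobian.norm_le {y : EuclideanSpace ℝ (Fin n)}
    {L : EuclideanSpace ℝ (Fin n) →L[ℝ] EuclideanSpace ℝ (Fin n)} (hL : IsSoftJacobian t y L)
    (w : EuclideanSpace ℝ (Fin n)) : ‖L w‖ ≤ ‖w‖ := by
  rw [EuclideanSpace.norm_eq, EuclideanSpace.norm_eq]
  refine Real.sqrt_le_sqrt (Finset.sum_le_sum fun i _ => ?_)
  rw [(hL i).1 w, norm_mul]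
  have h1 : ‖L (EuclideanSpace.single i 1) i‖ ≤ 1 := by
    rw [Real.norm_of_nonneg (hL i).2.1.1]; exact (hL i).2.1.2
  have := mul_le_of_le_one_right (norm_nonneg (w i)) h1
  gcongr

/-- The soft-thresholding map is affine on the segment from `y₀` to each nearby `y`, with each of
its generalized Jacobians at `y` as linear part. -/
theorem eventually_prox_l1norm_segment (ht : 0 < t) (y₀ : EuclideanSpace ℝ (Fin n)) :
    ∀ᶠ y in 𝓝 y₀, ∀ L, IsSoftJacobian t y L → ∀ s ∈ Set.Icc (0 : ℝ) 1,
      prox Set.univ (fun y => t * l1norm y) (y₀ + s • (y - y₀)) =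
        prox Set.univ (fun y => t * l1norm y) y₀ + s • L (y - y₀) := by
  have h : ∀ i, ∀ᶠ y : EuclideanSpace ℝ (Fin n) in 𝓝 y₀, ∀ D : ℝ, (t < |y i| → D = 1) →
      (|y i| < t → D = 0) → ∀ s ∈ Set.Icc (0 : ℝ) 1,
      soft t (y₀ i + s * (y i - y₀ i)) = soft t (y₀ i) + s * (D * (y i - y₀ i)) := fun i =>
    ((EuclideanSpace.proj (𝕜 := ℝ) i).continuous.tendsto y₀).eventually
      (eventually_soft_segment ht (y₀ i))
  filter_upwards [eventually_all.2 h] with y hy L hL s hs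
  rw [prox_l1norm ht.le, prox_l1norm ht.le]
  ext i
  have := hy i _ (hL i).2.2.1 (hL i).2.2.2 s hs
  simp only [PiLp.add_apply, PiLp.smul_apply, PiLp.sub_apply, smul_eq_mul]
  rw [this, (hL i).1 (y - y₀)]
  simp only [PiLp.sub_apply]
  ring

end SoftVec

/-! ### The projection onto a polyhedron and its HS-Jacobian -/

section Polyhedron

variable {E : Type*} [NormedAddCommGroup E] [InnerProductSpace ℝ E]
variable {ι κ : Type*} {b : ι → E} {β : ι → ℝ} {a : κ → E} {α : κ → ℝ}

theorem isClosed_polyhedron : IsClosed (polyhedron b β a α) := by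
  refine IsClosed.and ?_ ?_
  · simp only [Set.ofPred_forall]
    exact isClosed_iInter fun i => isClosed_le continuous_const
      (continuous_const.inner continuous_id)
  · simp only [Set.ofPred_forall]
    exact isClosed_iInter fun k => isClosed_eq (continuous_const.inner continuous_id)
      continuous_const

theorem convex_polyhedron : Convex ℝ (polyhedron b β a α) := by
  intro x hx y hy s t hs ht hst
  refine ⟨fun i => ?_, fun k => ?_⟩
  · rw [inner_add_right, inner_smul_right, inner_smul_right]
    have h1 := mul_le_mul_of_nonneg_left (hx.1 i) hs
    have h2 := mul_le_mul_of_nonneg_left (hy.1 i) ht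
    have h3 : β i = s * β i + t * β i := by rw [← add_mul, hst, one_mul]
    linarith
  · rw [inner_add_right, inner_smul_right, inner_smul_right, hx.2 k, hy.2 k, ← add_mul, hst,
      one_mul]

theorem isProxPoint_polyhedron [CompleteSpace E] (hne : (polyhedron b β a α).Nonempty) (z : E) :
    IsProxPoint (polyhedron b β a α) (fun _ => 0) z (proj (polyhedron b β a α) z) :=
  isProxPoint_proj hne isClosed_polyhedron convex_polyhedron z

theorem continuous_proj_polyhedron [CompleteSpace E] (hne : (polyhedron b β a α).Nonempty) :
    Continuous (proj (polyhedron b β a α)) :=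
  (LipschitzWith.of_dist_le_mul (K := 1) fun x y => by
    simpa [dist_eq_norm] using
      (isProxPoint_polyhedron hne x).norm_sub_le (isProxPoint_polyhedron hne y)).continuous

variable [Fintype ι] [Fintype κ]

variable (b a) in
/-- The cone of all combinations of the vectors `b i` (`i ∈ K`), with nonnegative coefficients, and
of the vectors `a k`, with arbitrary coefficients. -/
def multiplierCone (K : Set ι) : Set E :=
  {y | ∃ (l : ι → ℝ) (ν : κ → ℝ), (∀ i, 0 ≤ l i) ∧ (∀ i, l i ≠ 0 → i ∈ K) ∧
    y = ∑ i, l i • b i + ∑ k, ν k • a k}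

open Classical in
theorem isClosed_multiplierCone {K : Set ι}
    (hK : LinearIndependent ℝ (Sum.elim (fun i : K => b i) a)) :
    IsClosed (multiplierCone b a K) := by
  have hcl : IsClosed {c : K ⊕ κ → ℝ | ∀ i : K, 0 ≤ c (Sum.inl i)} := by
    simp only [Set.ofPred_forall]
    exact isClosed_iInter fun i => isClosed_le continuous_const (continuous_apply _)
  have hemb := LinearMap.isClosedEmbedding_of_injective (𝕜 := ℝ)
    (LinearMap.ker_eq_bot.2 (hK.fintypeLinearCombination_injective))
  have hsum : ∀ l : ι → ℝ, (∀ i, l i ≠ 0 → i ∈ K) → ∑ i, l i • b i = ∑ i : K, l i • b i := by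
    intro l hl
    rw [← Finset.sum_subset (Finset.subset_univ K.toFinset),
      Finset.sum_subtype (p := fun i => i ∈ K)]
    · simp
    · intro i _ hi
      rw [Set.mem_toFinset] at hi
      rw [not_not.1 (mt (hl i) hi), zero_smul]
  convert hemb.isClosedMap _ hcl using 1
  ext y
  simp only [multiplierCone, Set.mem_image, Set.mem_ofPred_eq, Fintype.linearCombination_apply,
    Fintype.sum_sum_type, Sum.elim_inl, Sum.elim_inr]
  constructor
  · rintro ⟨l, ν, hl, hlK, rfl⟩
    exact ⟨Sum.elim (fun i => l i) ν, fun i => hl i, by rw [hsum l hlK]; rfl⟩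
  · rintro ⟨c, hc, rfl⟩
    refine ⟨fun i => if h : i ∈ K then c (Sum.inl ⟨i, h⟩) else 0, fun k => c (Sum.inr k),
      fun i => ?_, fun i h => ?_, ?_⟩
    · by_cases h : i ∈ K
      · simpa [h] using hc _
      · simp [h]
    · by_contra h'
      simp [h'] at h
    · rw [hsum _ fun i h => by by_contra h'; simp [h'] at h]
      simp

theorem mem_hsIndexSets_iff {z : E} {K : Set ι} :
    K ∈ hsIndexSets b β a α z ↔
      LinearIndependent ℝ (Sum.elim (fun i : K => b i) a) ∧
      (∀ i ∈ K, inner ℝ (b i) (proj (polyhedron b β a α) z) = β i) ∧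
      proj (polyhedron b β a α) z - z ∈ multiplierCone b a K := by
  constructor
  · rintro ⟨⟨l, ν, ⟨h1, h2, h3⟩, h4⟩, h5, h6⟩
    exact ⟨h6, h5, l, ν, h2, h4, h1⟩
  · rintro ⟨h6, h5, l, ν, h2, h4, h1⟩
    refine ⟨⟨l, ν, ⟨h1, h2, fun i => ?_⟩, h4⟩, h5, h6⟩
    by_cases h : l i = 0
    · rw [h, zero_mul]
    · rw [h5 i (h4 i h), sub_self, mul_zero]

theorem inner_nonneg_of_mem_multiplierCone {K : Set ι} {x y w : E}
    (hy : y ∈ multiplierCone b a K) (hx : x ∈ polyhedron b β a α)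
    (hxK : ∀ i ∈ K, inner ℝ (b i) x = β i) (hw : w ∈ polyhedron b β a α) :
    0 ≤ inner ℝ y (w - x) := by
  obtain ⟨l, ν, hl, hlK, rfl⟩ := hy
  rw [inner_add_left, sum_inner, sum_inner]
  refine add_nonneg (Finset.sum_nonneg fun i _ => ?_) (Finset.sum_nonneg fun k _ => ?_)
  · rw [real_inner_smul_left]
    by_cases h : l i = 0
    · simp [h]
    · rw [inner_sub_right, hxK i (hlK i h)]
      exact mul_nonneg (hl i) (sub_nonneg.2 (hw.1 i))
  · rw [real_inner_smul_left, inner_sub_right, hx.2, hw.2, sub_self, mul_zero]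

theorem mem_span_of_mem_multiplierCone {K : Set ι} {y : E} (hy : y ∈ multiplierCone b a K) :
    y ∈ Submodule.span ℝ (b '' K ∪ Set.range a) := by
  obtain ⟨l, ν, -, hlK, rfl⟩ := hy
  refine add_mem (sum_mem fun i _ => ?_) (sum_mem fun k _ => ?_)
  · by_cases h : l i = 0
    · simp [h]
    · exact Submodule.smul_mem _ _ (Submodule.subset_span (Or.inl ⟨i, hlK i h, rfl⟩))
  · exact Submodule.smul_mem _ _ (Submodule.subset_span (Or.inr ⟨k, rfl⟩))

theorem mem_orthogonal_span {S : Set E} {v : E} (h : ∀ g ∈ S, inner ℝ g v = 0) :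
    v ∈ (Submodule.span ℝ S)ᗮ := by
  rw [Submodule.mem_orthogonal]
  intro g hg
  induction hg using Submodule.span_induction with
  | mem g hg => exact h g hg
  | zero => simp
  | add x y _ _ hx hy => rw [inner_add_left, hx, hy, add_zero]
  | smul c x _ hx => rw [real_inner_smul_left, hx, mul_zero]

variable [FiniteDimensional ℝ E]

/-- The set of points at which `K` is a Han-Sun index set is closed, since the cone generated by
linearly independent vectors is closed. -/
theorem isClosed_setOf_mem_hsIndexSets (hne : (polyhedron b β a α).Nonempty) (K : Set ι) :
    IsClosed {z | K ∈ hsIndexSets b β a α z} := by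
  simp only [mem_hsIndexSets_iff]
  have hcont := continuous_proj_polyhedron hne
  by_cases hK : LinearIndependent ℝ (Sum.elim (fun i : K => b i) a)
  · simp only [hK, true_and]
    refine IsClosed.and ?_ ((isClosed_multiplierCone hK).preimage (hcont.sub continuous_id))
    simp only [Set.ofPred_forall]
    exact isClosed_iInter fun i => isClosed_iInter fun _ =>
      isClosed_eq (continuous_const.inner hcont) continuous_const
  · simp [hK]

theorem eventually_hsIndexSets_subset (hne : (polyhedron b β a α).Nonempty) (z₀ : E) :
    ∀ᶠ z in 𝓝 z₀, hsIndexSets b β a α z ⊆ hsIndexSets b β a α z₀ := by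
  have h : ∀ K : Set ι, ∀ᶠ z in 𝓝 z₀,
      K ∈ hsIndexSets b β a α z → K ∈ hsIndexSets b β a α z₀ := by
    intro K
    by_cases hK : K ∈ hsIndexSets b β a α z₀
    · exact Eventually.of_forall fun _ _ => hK
    · filter_upwards [(isClosed_setOf_mem_hsIndexSets hne K).isOpen_compl.mem_nhds hK] with z hz h
      exact absurd h hz
  filter_upwards [eventually_all.2 h] with z hz K hK using hz K hK

/-- If `K` is a Han-Sun index set at both end points of a segment, then the projection is affine on
the segment, with the element of the HS-Jacobian given by `K` as linear part. -/
theorem proj_polyhedron_segment (hne : (polyhedron b β a α).Nonempty) {z₀ z : E} {K : Set ι}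
    (hK₀ : K ∈ hsIndexSets b β a α z₀) (hK : K ∈ hsIndexSets b β a α z) {s : ℝ}
    (hs : s ∈ Set.Icc (0 : ℝ) 1) :
    proj (polyhedron b β a α) (z₀ + s • (z - z₀)) = proj (polyhedron b β a α) z₀ +
      s • (Submodule.span ℝ (b '' K ∪ Set.range a))ᗮ.starProjection (z - z₀) := by
  rw [mem_hsIndexSets_iff] at hK₀ hK
  obtain ⟨-, hact₀, hcone₀⟩ := hK₀
  obtain ⟨-, hact, hcone⟩ := hK
  have hx₀ := (isProxPoint_polyhedron hne z₀).1
  have hx := (isProxPoint_polyhedron hne z).1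
  set x₀ := proj (polyhedron b β a α) z₀
  set x := proj (polyhedron b β a α) z
  have hH : (Submodule.span ℝ (b '' K ∪ Set.range a))ᗮ.starProjection (z - z₀) = x - x₀ := by
    refine Submodule.eq_starProjection_of_mem_orthogonal (mem_orthogonal_span ?_) ?_
    · rintro g (⟨i, hi, rfl⟩ | ⟨k, rfl⟩)
      · rw [inner_sub_right, hact i hi, hact₀ i hi, sub_self]
      · rw [inner_sub_right, hx.2, hx₀.2, sub_self]
    · refine Submodule.le_orthogonal_orthogonal _ ?_
      have := sub_mem (mem_span_of_mem_multiplierCone hcone₀) (mem_span_of_mem_multiplierCone hcone)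
      convert this using 1
      abel
  have hmem : x₀ + s • (x - x₀) ∈ polyhedron b β a α :=
    convex_polyhedron.add_smul_sub_mem hx₀ hx hs
  have hactive : ∀ i ∈ K, inner ℝ (b i) (x₀ + s • (x - x₀)) = β i := by
    intro i hi
    rw [inner_add_right, inner_smul_right, inner_sub_right, hact i hi, hact₀ i hi]
    ring
  rw [hH]
  refine IsProxPoint.prox_eq (f := fun _ => 0) ⟨hmem, fun w hw => ?_⟩
  have h₀ := inner_nonneg_of_mem_multiplierCone hcone₀ hmem hactive hw
  have h₁ := inner_nonneg_of_mem_multiplierCone hcone hmem hactive hw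
  have e : z₀ + s • (z - z₀) - (x₀ + s • (x - x₀)) = -((1 - s) • (x₀ - z₀) + s • (x - z)) := by
    module
  rw [e, inner_neg_left, inner_add_left, real_inner_smul_left, real_inner_smul_left]
  have := mul_nonneg (sub_nonneg.2 hs.2) h₀
  have := mul_nonneg hs.1 h₁
  linarith

/-- Near `z₀`, each element of the HS-Jacobian is the orthogonal projector onto the orthogonal
complement of the normals of constraints active at the projection of `z₀`, and the projection is
affine on the segment from `z₀`, with this projector as linear part. -/
theorem eventually_proj_polyhedron_segment (hne : (polyhedron b β a α).Nonempty) (z₀ : E) :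
    ∀ᶠ z in 𝓝 z₀, ∀ H ∈ hsJacobian b β a α z,
      (∃ K : Set ι, (∀ i ∈ K, inner ℝ (b i) (proj (polyhedron b β a α) z₀) = β i) ∧
        H = (Submodule.span ℝ (b '' K ∪ Set.range a))ᗮ.starProjection) ∧
      ∀ s ∈ Set.Icc (0 : ℝ) 1, proj (polyhedron b β a α) (z₀ + s • (z - z₀)) =
        proj (polyhedron b β a α) z₀ + s • H (z - z₀) := by
  filter_upwards [eventually_hsIndexSets_subset hne z₀] with z hz
  rintro H ⟨K, hK, rfl⟩
  exact ⟨⟨K, (hz hK).2.1, rfl⟩, fun s hs => proj_polyhedron_segment hne (hz hK) hK hs⟩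

end Polyhedron

/-! ### Constraint nondegeneracy -/

section Nondegeneracy

variable {E F : Type*} [NormedAddCommGroup E] [InnerProductSpace ℝ E]
  [NormedAddCommGroup F] [InnerProductSpace ℝ F]

theorem inner_eq_zero_of_mem_linearitySpace {C : Set E} {x g d : E}
    (hmin : ∀ w ∈ C, inner ℝ g x ≤ inner ℝ g w)
    (hd : d ∈ linearitySpace (posTangentConeAt C x)) : inner ℝ g d = 0 :=
  IsLocalMinOn.hasFDerivWithinAt_eq_zero (f := innerSL ℝ g) (s := C) (a := x)
    (IsMinOn.localize fun w hw => by simpa using hmin w hw)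
    (innerSL ℝ g).hasFDerivWithinAt hd.1 hd.2

theorem linearitySpace_subset_orthogonal {ι κ : Type*} {b : ι → E} {β : ι → ℝ} {a : κ → E}
    {α : κ → ℝ} {x : E} (hx : x ∈ polyhedron b β a α) {K : Set ι}
    (hK : ∀ i ∈ K, inner ℝ (b i) x = β i) :
    linearitySpace (posTangentConeAt (polyhedron b β a α) x) ⊆
      (Submodule.span ℝ (b '' K ∪ Set.range a))ᗮ := by
  refine fun d hd => mem_orthogonal_span ?_
  rintro g (⟨i, hi, rfl⟩ | ⟨k, rfl⟩)
  · exact inner_eq_zero_of_mem_linearitySpace (fun w hw => by rw [hK i hi]; exact hw.1 i) hd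
  · exact inner_eq_zero_of_mem_linearitySpace (fun w hw => by rw [hx.2, hw.2]) hd

/-- If `A` maps `L` onto the whole space, then `A S Aᵀ` is positive definite, uniformly over the
orthogonal projectors `S` onto subspaces that contain `L`. -/
theorem exists_pos_le_norm_starProjection [FiniteDimensional ℝ E] [FiniteDimensional ℝ F]
    {A : E →L[ℝ] F} {B : F →L[ℝ] E} (hAB : ∀ x y, inner ℝ (B y) x = inner ℝ y (A x))
    {L : Set E} (hL : A '' L = Set.univ) :
    ∃ c > 0, ∀ S : Submodule ℝ E, L ⊆ S → ∀ w, c * ‖w‖ ^ 2 ≤ ‖S.starProjection (B w)‖ ^ 2 := by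
  set W := Submodule.span ℝ L
  have hsurj : LinearMap.range ((A : E →ₗ[ℝ] F).domRestrict W) = ⊤ := by
    rw [LinearMap.range_eq_top]
    intro y
    obtain ⟨x, hx, rfl⟩ : y ∈ A '' L := hL ▸ Set.mem_univ y
    exact ⟨⟨x, Submodule.subset_span hx⟩, rfl⟩
  obtain ⟨g, hg⟩ := LinearMap.exists_rightInverse_of_surjective _ hsurj
  set G := LinearMap.toContinuousLinearMap g
  have hc : 0 < ‖G‖ + 1 := by positivity
  refine ⟨1 / (‖G‖ + 1) ^ 2, by positivity, fun S hS w => ?_⟩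
  have hWS : W ≤ S := Submodule.span_le.2 hS
  have h1 : A (g w : E) = w := LinearMap.congr_fun hg w
  have h2 : S.starProjection (g w : E) = g w :=
    Submodule.starProjection_eq_self_iff.2 (hWS (g w).2)
  have h3 : ‖w‖ ^ 2 = inner ℝ (S.starProjection (B w)) (g w : E) := by
    rw [Submodule.inner_starProjection_left_eq_right, h2, hAB, h1, real_inner_self_eq_norm_sq]
  have h4 : ‖(g w : E)‖ ≤ (‖G‖ + 1) * ‖w‖ :=
    (G.le_opNorm w).trans (by gcongr; linarith)
  have h5 : ‖w‖ ≤ (‖G‖ + 1) * ‖S.starProjection (B w)‖ := by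
    rcases (norm_nonneg w).eq_or_lt with h | h
    · rw [← h]; positivity
    · refine le_of_mul_le_mul_right ?_ h
      calc ‖w‖ * ‖w‖ = inner ℝ (S.starProjection (B w)) (g w : E) := by rw [← h3, sq]
        _ ≤ ‖S.starProjection (B w)‖ * ‖(g w : E)‖ := real_inner_le_norm _ _
        _ ≤ ‖S.starProjection (B w)‖ * ((‖G‖ + 1) * ‖w‖) := by gcongr
        _ = (‖G‖ + 1) * ‖S.starProjection (B w)‖ * ‖w‖ := by ring
  rw [div_mul_eq_mul_div, one_mul, div_le_iff₀ (by positivity), ← mul_pow, mul_comm]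
  gcongr

end Nondegeneracy

/-! ### Galerkin orthogonality of the conjugate gradient method -/

section ConjugateGradient

variable {E : Type*} [NormedAddCommGroup E] [InnerProductSpace ℝ E]

/-- The `n`-th state of the conjugate gradient method for `M d = c`, started at `d = 0`. -/
def cgState (M : E →L[ℝ] E) (c : E) (n : ℕ) : CGState E := (cgStep M)^[n] ⟨0, c, c⟩

variable {M : E →L[ℝ] E} {c : E}

theorem cgState_succ (n : ℕ) : cgState M c (n + 1) = cgStep M (cgState M c n) :=
  Function.iterate_succ_apply' _ _ _

theorem cgState_residual (n : ℕ) : (cgState M c n).r = c - M (cgState M c n).x := by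
  induction n with
  | zero => simp [cgState]
  | succ n ih =>
    rw [cgState_succ]
    simp only [cgStep, map_add, map_smul]
    rw [ih]
    abel

theorem cgState_r_succ_eq_zero {n : ℕ} (h : (cgState M c n).r = 0) :
    (cgState M c (n + 1)).r = 0 := by
  rw [cgState_succ]
  simp [cgStep, h]

/-- The invariants of the conjugate gradient method: the residual is orthogonal to the earlier
search directions, and the search direction is conjugate to the earlier ones. -/
theorem cgState_orthogonal (hsymm : ∀ v w, inner ℝ (M v) w = inner ℝ v (M w))
    (hpos : ∀ v, v ≠ 0 → 0 < inner ℝ (M v) v) (n : ℕ) :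
    inner ℝ (cgState M c n).r (cgState M c n).p = inner ℝ (cgState M c n).r (cgState M c n).r ∧
    ∀ i < n, inner ℝ (cgState M c n).r (cgState M c i).p = 0 ∧
      inner ℝ (M (cgState M c n).p) (cgState M c i).p = 0 := by
  induction n with
  | zero => simp [cgState]
  | succ n ih =>
    obtain ⟨ih1, ih2⟩ := ih
    set r := fun k => (cgState M c k).r with hr
    set p := fun k => (cgState M c k).p with hp
    set a : ℕ → ℝ := fun k => inner ℝ (r k) (r k) / inner ℝ (p k) (M (p k)) with ha
    set b : ℕ → ℝ := fun k => inner ℝ (r (k + 1)) (r (k + 1)) / inner ℝ (r k) (r k) with hb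
    have hrs : ∀ k, r (k + 1) = r k - a k • M (p k) := fun k => by
      simp only [hr, cgState_succ]; rfl
    have hps : ∀ k, p (k + 1) = r (k + 1) + b k • p k := fun k => by
      simp only [hp, hb, hr, cgState_succ]; rfl
    have hp0 : p 0 = r 0 := rfl
    change inner ℝ (r n) (p n) = inner ℝ (r n) (r n) at ih1
    change ∀ i < n, inner ℝ (r n) (p i) = 0 ∧ inner ℝ (M (p n)) (p i) = 0 at ih2
    change inner ℝ (r (n + 1)) (p (n + 1)) = inner ℝ (r (n + 1)) (r (n + 1)) ∧
      ∀ i < n + 1, inner ℝ (r (n + 1)) (p i) = 0 ∧ inner ℝ (M (p (n + 1))) (p i) = 0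
    have hMp : ∀ k, p k ≠ 0 → inner ℝ (p k) (M (p k)) ≠ 0 := fun k hk => by
      rw [← hsymm]; exact (hpos _ hk).ne'
    have horth : ∀ i < n + 1, inner ℝ (r (n + 1)) (p i) = 0 := by
      intro i hi
      rw [hrs, inner_sub_left, real_inner_smul_left]
      rcases Nat.lt_succ_iff_lt_or_eq.1 hi with h | rfl
      · rw [(ih2 i h).1, (ih2 i h).2, mul_zero, sub_zero]
      · by_cases h0 : p i = 0
        · simp [h0]
        · rw [ih1, hsymm, ha, div_mul_cancel₀ _ (hMp i h0), sub_self]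
    have horth' : ∀ i < n + 1, inner ℝ (r (n + 1)) (r i) = 0 := by
      intro i hi
      cases i with
      | zero => rw [← hp0]; exact horth 0 hi
      | succ k =>
        have e : r (k + 1) = p (k + 1) - b k • p k := by rw [hps, add_sub_cancel_right]
        rw [e, inner_sub_right, horth _ hi, inner_smul_right, horth _ (Nat.lt_of_succ_lt hi),
          mul_zero, sub_zero]
    have hzero : ∀ i k, r i = 0 → r (i + k) = 0 := by
      intro i k h
      induction k with
      | zero => exact h
      | succ k ihk => exact cgState_r_succ_eq_zero ihk
    refine ⟨?_, fun i hi => ⟨horth i hi, ?_⟩⟩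
    · rw [hps, inner_add_right, inner_smul_right, horth n n.lt_succ_self, mul_zero, add_zero]
    · by_cases hpi : p i = 0
      · simp [hpi]
      by_cases hri : r i = 0
      · -- The method has terminated, so that the new search direction vanishes.
        have h1 : r (n + 1) = 0 := by
          have := hzero i (n + 1 - i) hri
          rwa [Nat.add_sub_cancel' hi.le] at this
        have h2 : b n = 0 := by simp [hb, h1]
        rw [hps, h1, h2]
        simp
      have hrr : inner ℝ (r i) (r i) ≠ 0 := inner_self_ne_zero.2 hri
      have hai : a i ≠ 0 := div_ne_zero hrr (hMp i hpi)
      have hM : inner ℝ (r (n + 1)) (M (p i)) * a i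
          = inner ℝ (r (n + 1)) (r i) - inner ℝ (r (n + 1)) (r (i + 1)) := by
        rw [hrs i, inner_sub_right, inner_smul_right]; ring
      rw [hps, map_add, map_smul, inner_add_left, real_inner_smul_left, hsymm]
      rcases Nat.lt_succ_iff_lt_or_eq.1 hi with h | rfl
      · rw [(ih2 i h).2, mul_zero, add_zero]
        rw [horth' i hi, horth' (i + 1) (Nat.succ_lt_succ h), sub_zero] at hM
        exact (mul_eq_zero.1 hM).resolve_right hai
      · rw [horth' i hi, zero_sub] at hM
        refine mul_right_cancel₀ hai ?_
        rw [add_mul, hM, zero_mul, hsymm, mul_assoc, mul_comm _ (a i)]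
        simp only [ha, hb]
        rw [div_mul_cancel₀ _ (hMp i hpi), div_mul_cancel₀ _ hrr, neg_add_cancel]

/-- The residual of a conjugate gradient iterate is orthogonal to the iterate. -/
theorem inner_residual_cgIterate (hsymm : ∀ v w, inner ℝ (M v) w = inner ℝ v (M w))
    (hpos : ∀ v, v ≠ 0 → 0 < inner ℝ (M v) v) (n : ℕ) :
    inner ℝ (c - M (cgIterate M c n)) (cgIterate M c n) = 0 := by
  have key : ∀ k ≤ n, inner ℝ (cgState M c n).r (cgState M c k).x = 0 := by
    intro k
    induction k with
    | zero => simp [cgState]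
    | succ k ih =>
      intro hk
      rw [cgState_succ]
      simp only [cgStep]
      rw [inner_add_right, inner_smul_right, ih (Nat.le_of_succ_le hk),
        ((cgState_orthogonal hsymm hpos n).2 k hk).1, mul_zero, add_zero]
  have := key n le_rfl
  rwa [cgState_residual] at this

end ConjugateGradient

/-! ### Convex functions with Lipschitz continuous gradient -/

section Smooth

variable {E : Type*} [NormedAddCommGroup E] [InnerProductSpace ℝ E] {ψ : E → ℝ} {F : E → E}
  {L : ℝ}

theorem le_add_inner_add_sq (hsub : ∀ u v, ψ u + inner ℝ (F u) (v - u) ≤ ψ v)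
    (hL : ∀ u v, ‖F u - F v‖ ≤ L * ‖u - v‖) (u v : E) :
    ψ v ≤ ψ u + inner ℝ (F u) (v - u) + L * ‖v - u‖ ^ 2 := by
  have h1 := hsub v u
  have h2 : inner ℝ (F v - F u) (v - u) ≤ L * ‖v - u‖ ^ 2 := calc
    _ ≤ ‖F v - F u‖ * ‖v - u‖ := real_inner_le_norm _ _
    _ ≤ L * ‖v - u‖ * ‖v - u‖ := by gcongr; exact hL v u
    _ = L * ‖v - u‖ ^ 2 := by ring
  rw [inner_sub_left] at h2
  rw [← neg_sub v u, inner_neg_right] at h1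
  linarith

theorem hasGradientAt_of_subgradient [CompleteSpace E]
    (hsub : ∀ u v, ψ u + inner ℝ (F u) (v - u) ≤ ψ v)
    (hL : ∀ u v, ‖F u - F v‖ ≤ L * ‖u - v‖) (u : E) : HasGradientAt ψ (F u) u := by
  rw [hasGradientAt_iff_isLittleO]
  have h1 : (fun v => ψ v - ψ u - inner ℝ (F u) (v - u)) =O[𝓝 u] fun v => ‖v - u‖ ^ 2 := by
    refine Asymptotics.IsBigO.of_bound L (Eventually.of_forall fun v => ?_)
    have h2 := hsub u v
    have h3 := le_add_inner_add_sq hsub hL u v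
    rw [Real.norm_of_nonneg (by linarith), Real.norm_of_nonneg (by positivity)]
    linarith
  refine h1.trans_isLittleO ?_
  have h2 : Tendsto (fun v => v - u) (𝓝 u) (𝓝 0) := by
    simpa using (continuous_id.sub continuous_const).tendsto u (f := fun v : E => v - u)
  exact (Asymptotics.isLittleO_norm_pow_id one_lt_two).comp_tendsto h2

/-- If the gradient is positively homogeneous along a segment that starts at a critical point,
then the function is exactly quadratic on it. -/
theorem eq_add_half_inner_of_homogeneous [CompleteSpace E] (hgrad : ∀ u, HasGradientAt ψ (F u) u)
    {x h g : E} (hF : ∀ s ∈ Set.Icc (0 : ℝ) 1, F (x + s • h) = s • g) :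
    ψ (x + h) = ψ x + 1 / 2 * inner ℝ g h := by
  have hderiv : ∀ s ∈ Set.uIcc (0 : ℝ) 1,
      HasDerivAt (fun s : ℝ => ψ (x + s • h)) (s * inner ℝ g h) s := by
    intro s hs
    rw [Set.uIcc_of_le zero_le_one] at hs
    have h1 : HasDerivAt (fun s : ℝ => x + s • h) h s := by
      simpa using ((hasDerivAt_id s).smul_const h).const_add x
    have h2 := (hgrad (x + s • h)).hasFDerivAt.comp_hasDerivAt s h1
    have h3 : s * inner ℝ g h = inner ℝ (F (x + s • h)) h := by
      rw [hF s hs, real_inner_smul_left]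
    rw [h3]
    simpa [Function.comp_def] using h2
  have h3 := intervalIntegral.integral_eq_sub_of_hasDerivAt hderiv
    ((continuous_id.mul continuous_const).intervalIntegrable 0 1)
  have h4 : ∫ s in (0 : ℝ)..1, s * inner ℝ g h = 1 / 2 * inner ℝ g h := by
    rw [intervalIntegral.integral_mul_const, integral_id]
    norm_num
  rw [h4] at h3
  simp only [one_smul, zero_smul, add_zero] at h3
  linarith

end Smooth

/-! ### Inexact regularized Newton directions -/

section Regularization

theorem υ₁_pos (Q : Params) : 0 < Q.υ₁ := zero_lt_one.trans Q.one_lt_υ₁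

variable {E : Type*} [NormedAddCommGroup E]

theorem regularization_nonneg (Q : Params) (g : E) : 0 ≤ Q.υ₁ * min Q.υ₂ ‖g‖ :=
  mul_nonneg (υ₁_pos Q).le (le_min Q.υ₂_mem.1.le (norm_nonneg g))

theorem regularization_le (Q : Params) (g : E) : Q.υ₁ * min Q.υ₂ ‖g‖ ≤ Q.υ₁ :=
  mul_le_of_le_one_right (υ₁_pos Q).le ((min_le_left _ _).trans Q.υ₂_mem.2.le)

end Regularization

section Direction

variable {E : Type*} [NormedAddCommGroup E] [InnerProductSpace ℝ E]

/-- The regularized Newton matrix `V + υ₁ min {υ₂, ‖g‖} I` at a point with gradient `g`. -/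
def regularized (Q : Params) (V : E →L[ℝ] E) (g : E) : E →L[ℝ] E :=
  V + (Q.υ₁ * min Q.υ₂ ‖g‖) • ContinuousLinearMap.id ℝ E

/-- `d` is an exact solution or a conjugate gradient iterate of the regularized Newton equation
for the generalized Hessian `V` and the gradient `g`, with the prescribed accuracy. -/
def IsInexactDirection (Q : Params) (V : E →L[ℝ] E) (g d : E) : Prop :=
  (regularized Q V g d = -g ∨ ∃ n, d = cgIterate (regularized Q V g) (-g) n) ∧
    ‖regularized Q V g d + g‖ ≤ min Q.ϱbar (‖g‖ ^ (1 + Q.τ))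

variable {Q : Params} {V : E →L[ℝ] E} {g d : E} {κ Λ : ℝ}

theorem regularized_apply (w : E) : regularized Q V g w = V w + (Q.υ₁ * min Q.υ₂ ‖g‖) • w := rfl

theorem inner_le_inner_regularized (w : E) :
    inner ℝ (V w) w ≤ inner ℝ (regularized Q V g w) w := by
  rw [regularized_apply, inner_add_left, real_inner_smul_left, real_inner_self_eq_norm_sq]
  have := mul_nonneg (regularization_nonneg Q g) (sq_nonneg ‖w‖)
  linarith

theorem IsInexactDirection.inner_residual (hd : IsInexactDirection Q V g d)
    (hsymm : ∀ v w, inner ℝ (V v) w = inner ℝ v (V w))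
    (hpos : ∀ w, w ≠ 0 → 0 < inner ℝ (regularized Q V g w) w) :
    inner ℝ (regularized Q V g d + g) d = 0 := by
  rcases hd.1 with h | ⟨n, rfl⟩
  · rw [h, neg_add_cancel, inner_zero_left]
  · have hsymm' : ∀ v w, inner ℝ (regularized Q V g v) w = inner ℝ v (regularized Q V g w) := by
      intro v w
      rw [regularized_apply, regularized_apply, inner_add_left, inner_add_right, hsymm,
        real_inner_smul_left, inner_smul_right]
    have h := inner_residual_cgIterate (c := -g) hsymm' hpos n
    rw [← neg_add', inner_neg_left, neg_eq_zero, add_comm] at h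
    exact h

theorem IsInexactDirection.inner_nonpos (hd : IsInexactDirection Q V g d)
    (hsymm : ∀ v w, inner ℝ (V v) w = inner ℝ v (V w)) (hpsd : ∀ w, 0 ≤ inner ℝ (V w) w) :
    inner ℝ g d ≤ 0 := by
  rcases eq_or_ne g 0 with rfl | hg
  · simp
  have hpos : ∀ w, w ≠ 0 → 0 < inner ℝ (regularized Q V g w) w := by
    intro w hw
    rw [regularized_apply, inner_add_left, real_inner_smul_left, real_inner_self_eq_norm_sq]
    have h1 : 0 < min Q.υ₂ ‖g‖ := lt_min Q.υ₂_mem.1 (norm_pos_iff.2 hg)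
    have h2 := υ₁_pos Q
    have h3 := norm_pos_iff.2 hw
    have h4 := hpsd w
    positivity
  have h := hd.inner_residual hsymm hpos
  rw [inner_add_left] at h
  have := (hpsd d).trans (inner_le_inner_regularized (Q := Q) (g := g) d)
  linarith

theorem IsInexactDirection.sq_norm_le (hd : IsInexactDirection Q V g d)
    (hsymm : ∀ v w, inner ℝ (V v) w = inner ℝ v (V w)) (hκ : 0 < κ)
    (hV : ∀ w, κ * ‖w‖ ^ 2 ≤ inner ℝ (V w) w) : κ * ‖d‖ ^ 2 ≤ -inner ℝ g d := by
  have hpos : ∀ w, w ≠ 0 → 0 < inner ℝ (regularized Q V g w) w := fun w hw =>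
    lt_of_lt_of_le (by have := norm_pos_iff.2 hw; positivity)
      ((hV w).trans (inner_le_inner_regularized w))
  have h := hd.inner_residual hsymm hpos
  rw [inner_add_left] at h
  have := (hV d).trans (inner_le_inner_regularized (Q := Q) (g := g) d)
  linarith

theorem IsInexactDirection.le_norm (hd : IsInexactDirection Q V g d)
    (hV : ∀ w, ‖V w‖ ≤ Λ * ‖w‖) :
    ‖g‖ - min Q.ϱbar (‖g‖ ^ (1 + Q.τ)) ≤ (Λ + Q.υ₁) * ‖d‖ := by
  have h1 : ‖regularized Q V g d‖ ≤ (Λ + Q.υ₁) * ‖d‖ := by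
    rw [regularized_apply, add_mul]
    refine (norm_add_le _ _).trans (add_le_add (hV d) ?_)
    rw [norm_smul, Real.norm_of_nonneg (regularization_nonneg Q g)]
    gcongr
    exact regularization_le Q g
  have h2 := norm_sub_norm_le g (-regularized Q V g d)
  rw [norm_neg, sub_neg_eq_add, add_comm g] at h2
  have h3 := hd.2
  linarith

theorem mul_norm_le_of_coercive {M : E →L[ℝ] E} (hM : ∀ w, κ * ‖w‖ ^ 2 ≤ inner ℝ (M w) w) (w : E) :
    κ * ‖w‖ ≤ ‖M w‖ := by
  rcases (norm_nonneg w).eq_or_lt with h | h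
  · rw [← h, mul_zero]; exact norm_nonneg _
  · refine le_of_mul_le_mul_right ?_ h
    calc κ * ‖w‖ * ‖w‖ = κ * ‖w‖ ^ 2 := by ring
      _ ≤ inner ℝ (M w) w := hM w
      _ ≤ ‖M w‖ * ‖w‖ := real_inner_le_norm _ _

/-- If the gradient equals `V h`, with `h` the displacement from the solution, then the full step
leads to a displacement `h + d` that is bounded by the regularization and the residual. -/
theorem IsInexactDirection.norm_add_le (hd : IsInexactDirection Q V g d)
    (hV : ∀ w, κ * ‖w‖ ^ 2 ≤ inner ℝ (V w) w) {h : E} (hg : V h = g) :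
    κ * ‖h + d‖ ≤ Q.υ₁ * ‖g‖ * ‖h‖ + ‖g‖ ^ (1 + Q.τ) := by
  have h1 := mul_norm_le_of_coercive
    (fun w => (hV w).trans (inner_le_inner_regularized (Q := Q) (g := g) w)) (h + d)
  have h2 : regularized Q V g (h + d)
      = (Q.υ₁ * min Q.υ₂ ‖g‖) • h + (regularized Q V g d + g) := by
    rw [map_add, regularized_apply h, hg]; abel
  rw [h2] at h1
  refine h1.trans ((_root_.norm_add_le _ _).trans (add_le_add ?_ (hd.2.trans (min_le_right _ _))))
  rw [norm_smul, Real.norm_of_nonneg (regularization_nonneg Q g)]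
  have := υ₁_pos Q
  gcongr
  exact min_le_right _ _

end Direction

/-- The tolerance for the residual is smaller than the norm `t` of a nonzero gradient; in
particular, `d = 0` is then not an admissible direction. -/
theorem tolerance_lt (Q : Params) {t : ℝ} (ht : 0 < t) :
    min Q.ϱbar (t ^ (1 + Q.τ)) < t := by
  rcases le_or_gt 1 t with h | h
  · exact (min_le_left _ _).trans_lt (Q.ϱbar_mem.2.trans_le h)
  · refine (min_le_right _ _).trans_lt ?_
    conv_rhs => rw [← Real.rpow_one t]
    exact Real.rpow_lt_rpow_of_exponent_gt ht h (by linarith [Q.τ_mem.1])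

/-! ### Convergence of the semismooth Newton method -/

section Convergence

variable {E : Type*} [NormedAddCommGroup E] [InnerProductSpace ℝ E]

/-- The properties of an objective function `ψ` with gradient `F`, of a generalized Hessian `J` and
of a point `x` on which the convergence of the semismooth Newton method rests: `ψ` is convex with
Lipschitz continuous gradient, the generalized Hessians are symmetric and positive semidefinite,
and near `x` they are uniformly positive definite and bounded, and `F` is affine on the segments
that start at `x`, with the generalized Hessians at the end point as linear parts. -/
structure IsNewtonModel (ψ : E → ℝ) (F : E → E) (J : E → Set (E →L[ℝ] E)) (x : E)
    (L κ Λ : ℝ) : Prop where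
  L_pos : 0 < L
  κ_pos : 0 < κ
  Λ_nonneg : 0 ≤ Λ
  subgradient : ∀ u v, ψ u + inner ℝ (F u) (v - u) ≤ ψ v
  lipschitz : ∀ u v, ‖F u - F v‖ ≤ L * ‖u - v‖
  symmetric : ∀ u, ∀ V ∈ J u, ∀ v w, inner ℝ (V v) w = inner ℝ v (V w)
  nonneg : ∀ u, ∀ V ∈ J u, ∀ w, 0 ≤ inner ℝ (V w) w
  coercive : ∀ᶠ u in 𝓝 x, ∀ V ∈ J u, ∀ w, κ * ‖w‖ ^ 2 ≤ inner ℝ (V w) w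
  bounded : ∀ᶠ u in 𝓝 x, ∀ V ∈ J u, ∀ w, ‖V w‖ ≤ Λ * ‖w‖
  segment : ∀ᶠ u in 𝓝 x, ∀ V ∈ J u, ∀ s ∈ Set.Icc (0 : ℝ) 1,
    F (x + s • (u - x)) = F x + s • V (u - x)

/-- The numbers of backtracking steps after which the Armijo condition holds. -/
def armijoSet (Q : Params) (ψ : E → ℝ) (g u d : E) : Set ℕ :=
  {c : ℕ | ψ (u + Q.ϱ ^ c • d) ≤ ψ u + Q.ϑ * Q.ϱ ^ c * inner ℝ g d}

/-- `u` is generated by the semismooth Newton method for the objective function `ψ` with gradient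
`F` and generalized Hessian `J`. -/
def IsNewtonSequence (Q : Params) (ψ : E → ℝ) (F : E → E) (J : E → Set (E →L[ℝ] E))
    (u : ℕ → E) : Prop :=
  ∀ j, ∃ V ∈ J (u j), ∃ d, IsInexactDirection Q V (F (u j)) d ∧
    ∃ c, IsLeast (armijoSet Q ψ (F (u j)) (u j) d) c ∧ u (j + 1) = u j + Q.ϱ ^ c • d

variable {Q : Params} {ψ : E → ℝ} {F : E → E} {J : E → Set (E →L[ℝ] E)} {x : E} {L κ Λ : ℝ}
  {u : ℕ → E}

namespace IsNewtonModel

theorem antitone (h : IsNewtonModel ψ F J x L κ Λ) (hu : IsNewtonSequence Q ψ F J u) :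
    Antitone fun j => ψ (u j) := by
  refine antitone_nat_of_succ_le fun j => ?_
  obtain ⟨V, hV, d, hd, c, hc, hj⟩ := hu j
  have h1 := hd.inner_nonpos (h.symmetric _ V hV) (h.nonneg _ V hV)
  have h2 : ψ (u j + Q.ϱ ^ c • d) ≤ ψ (u j) + Q.ϑ * Q.ϱ ^ c * inner ℝ (F (u j)) d := hc.1
  have h3 : 0 ≤ Q.ϑ * Q.ϱ ^ c := mul_nonneg Q.ϑ_mem.1.le (pow_nonneg Q.ϱ_mem.1.le _)
  have h4 := mul_nonpos_of_nonneg_of_nonpos h3 h1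
  rw [hj]
  linarith

/-- Each step size below a fixed threshold passes the Armijo test, so that the line search takes a
bounded number of backtracking steps. -/
theorem mem_armijoSet (h : IsNewtonModel ψ F J x L κ Λ) {g v d : E} (hg : F v = g)
    (hd : κ * ‖d‖ ^ 2 ≤ -inner ℝ g d) {c : ℕ} (hc : Q.ϱ ^ c ≤ (1 - Q.ϑ) * κ / L) :
    c ∈ armijoSet Q ψ g v d := by
  have h1 := le_add_inner_add_sq h.subgradient h.lipschitz v (v + Q.ϱ ^ c • d)
  rw [add_sub_cancel_left, hg, inner_smul_right, norm_smul,
    Real.norm_of_nonneg (pow_nonneg Q.ϱ_mem.1.le c)] at h1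
  have h2 : 0 < Q.ϱ ^ c := pow_pos Q.ϱ_mem.1 c
  have h3 : 0 < 1 - Q.ϑ := by linarith [Q.ϑ_mem.2]
  rw [le_div_iff₀ h.L_pos] at hc
  have h4 : L * (Q.ϱ ^ c * ‖d‖) ^ 2 ≤ Q.ϱ ^ c * ((1 - Q.ϑ) * -inner ℝ g d) := calc
    L * (Q.ϱ ^ c * ‖d‖) ^ 2 = Q.ϱ ^ c * (Q.ϱ ^ c * L * ‖d‖ ^ 2) := by ring
    _ ≤ Q.ϱ ^ c * ((1 - Q.ϑ) * κ * ‖d‖ ^ 2) := by gcongr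
    _ = Q.ϱ ^ c * ((1 - Q.ϑ) * (κ * ‖d‖ ^ 2)) := by ring
    _ ≤ Q.ϱ ^ c * ((1 - Q.ϑ) * -inner ℝ g d) := by gcongr
  change ψ (v + Q.ϱ ^ c • d) ≤ ψ v + Q.ϑ * Q.ϱ ^ c * inner ℝ g d
  linarith

theorem continuous_grad (h : IsNewtonModel ψ F J x L κ Λ) : Continuous F :=
  (LipschitzWith.of_dist_le' fun u v => by
    simpa [dist_eq_norm] using h.lipschitz u v).continuous

variable [CompleteSpace E]

theorem hasGradientAt (h : IsNewtonModel ψ F J x L κ Λ) (u : E) : HasGradientAt ψ (F u) u :=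
  hasGradientAt_of_subgradient h.subgradient h.lipschitz u

theorem continuous_fun (h : IsNewtonModel ψ F J x L κ Λ) : Continuous ψ :=
  continuous_iff_continuousAt.2 fun u => (h.hasGradientAt u).hasFDerivAt.continuousAt

theorem le_of_mapClusterPt (h : IsNewtonModel ψ F J x L κ Λ) (hu : IsNewtonSequence Q ψ F J u)
    (hx : MapClusterPt x atTop u) (j : ℕ) : ψ x ≤ ψ (u j) := by
  by_contra! hlt
  have h1 := hx.frequently (h.continuous_fun.continuousAt.eventually (lt_mem_nhds hlt))
  obtain ⟨k, hk, hk'⟩ := (h1.and_eventually (eventually_ge_atTop j)).exists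
  exact absurd (h.antitone hu hk') (not_le.2 hk)

theorem gradient_eq_zero (h : IsNewtonModel ψ F J x L κ Λ) (hu : IsNewtonSequence Q ψ F J u)
    (hx : MapClusterPt x atTop u) : F x = 0 := by
  by_contra hne
  set G : E → ℝ := fun v => ‖F v‖ - min Q.ϱbar (‖F v‖ ^ (1 + Q.τ)) with hG
  have hGcont : Continuous G := by
    have h1 := h.continuous_grad.norm
    have h2 : 0 ≤ 1 + Q.τ := by linarith [Q.τ_mem.1]
    exact h1.sub (continuous_const.min (h1.rpow_const fun _ => Or.inr h2))
  have hGx : 0 < G x := sub_pos.2 (tolerance_lt Q (norm_pos_iff.2 hne))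
  obtain ⟨n, hn⟩ : ∃ n : ℕ, Q.ϱ ^ n < (1 - Q.ϑ) * κ / L := by
    refine exists_pow_lt_of_lt_one ?_ Q.ϱ_mem.2
    have := h.κ_pos
    have := h.L_pos
    have : 0 < 1 - Q.ϑ := by linarith [Q.ϑ_mem.2]
    positivity
  have hS : 0 < Λ + Q.υ₁ := add_pos_of_nonneg_of_pos h.Λ_nonneg (υ₁_pos Q)
  -- Each step from a point near `x` decreases `ψ` by at least `ω`.
  set ω : ℝ := Q.ϑ * Q.ϱ ^ n * (κ * (G x / 2 / (Λ + Q.υ₁)) ^ 2) with hω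
  have hω_pos : 0 < ω := by
    have := h.κ_pos
    have := Q.ϑ_mem.1
    have := Q.ϱ_mem.1
    positivity
  have hψ : ∀ᶠ v in 𝓝 x, ψ v < ψ x + ω :=
    h.continuous_fun.continuousAt.eventually (gt_mem_nhds (by linarith))
  have hGev : ∀ᶠ v in 𝓝 x, G x / 2 < G v :=
    hGcont.continuousAt.eventually (lt_mem_nhds (by linarith))
  obtain ⟨j, hj1, hj2, hj3, hj4⟩ :=
    (hx.frequently (hψ.and (hGev.and (h.coercive.and h.bounded)))).exists
  obtain ⟨V, hV, d, hd, c, hc, hj⟩ := hu j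
  have hdd := hd.sq_norm_le (h.symmetric _ V hV) h.κ_pos (hj3 V hV)
  have hcn : c ≤ n := hc.2 (h.mem_armijoSet rfl hdd hn.le)
  have hpow : Q.ϱ ^ n ≤ Q.ϱ ^ c := pow_le_pow_of_le_one Q.ϱ_mem.1.le Q.ϱ_mem.2.le hcn
  have hdl : G x / 2 / (Λ + Q.υ₁) ≤ ‖d‖ := by
    rw [div_le_iff₀ hS, mul_comm]
    exact hj2.le.trans (hd.le_norm (hj4 V hV))
  have hdec : ω ≤ Q.ϑ * Q.ϱ ^ c * -inner ℝ (F (u j)) d := by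
    have h1 : κ * (G x / 2 / (Λ + Q.υ₁)) ^ 2 ≤ -inner ℝ (F (u j)) d := by
      refine le_trans ?_ hdd
      have := h.κ_pos
      gcongr
    have := h.κ_pos
    have := Q.ϑ_mem.1
    have := Q.ϱ_mem.1
    rw [hω]
    gcongr
  have h1 : ψ (u j + Q.ϱ ^ c • d) ≤ ψ (u j) + Q.ϑ * Q.ϱ ^ c * inner ℝ (F (u j)) d := hc.1
  have h2 := h.le_of_mapClusterPt hu hx (j + 1)
  rw [hj] at h2
  linarith

/-- Near a critical point `x`, the full Newton step is accepted by the line search, and its error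
is of order `1 + τ`. The reason for the acceptance is that `ψ v - ψ x = 1/2 * ⟪F v, v - x⟫`, while
`ψ (v + d) - ψ x` is of higher order, and that `ϑ < 1/2`. -/
theorem eventually_full_step (h : IsNewtonModel ψ F J x L κ Λ) (hFx : F x = 0) :
    ∃ C, ∀ᶠ v in 𝓝 x, ∀ V ∈ J v, ∀ d, IsInexactDirection Q V (F v) d →
      ‖v + d - x‖ ≤ C * ‖v - x‖ ^ (1 + Q.τ) ∧ 0 ∈ armijoSet Q ψ (F v) v d := by
  have hκ := h.κ_pos
  have hL := h.L_pos
  have hυ := υ₁_pos Q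
  have hτ := Q.τ_mem
  set C := (Q.υ₁ * L + L ^ (1 + Q.τ)) / κ with hC
  have hC_pos : 0 < C := by
    have := Real.rpow_pos_of_pos hL (1 + Q.τ)
    positivity
  have hnorm : Tendsto (fun v => ‖v - x‖) (𝓝 x) (𝓝 0) := by
    simpa using (continuous_id.sub continuous_const).norm.tendsto x (f := fun v : E => ‖v - x‖)
  have hq : Tendsto (fun v => C * ‖v - x‖ ^ Q.τ) (𝓝 x) (𝓝 0) := by
    have := (hnorm.rpow_const (Or.inr hτ.1.le)).const_mul C
    simpa [Real.zero_rpow hτ.1.ne'] using this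
  have hϑ : 0 < (1 / 2 - Q.ϑ) * κ / (2 * L) := by
    have : 0 < 1 / 2 - Q.ϑ := by linarith [Q.ϑ_mem.2]
    positivity
  refine ⟨C, ?_⟩
  filter_upwards [h.coercive, h.segment, hnorm.eventually_lt_const one_pos,
    hq.eventually_lt_const one_pos, hq.eventually_lt_const hϑ] with v hcoer hseg h1 hq1 hq2 V hV d hd
  set e := v - x with he
  have hVe : V e = F v := by
    have := hseg V hV 1 (by simp)
    rw [one_smul, add_sub_cancel, hFx, zero_add, one_smul] at this
    exact this.symm
  have hFv : ‖F v‖ ≤ L * ‖e‖ := by simpa [hFx] using h.lipschitz v x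
  have hstep : ‖e + d‖ ≤ C * ‖e‖ ^ (1 + Q.τ) := by
    have h2 := hd.norm_add_le (hcoer V hV) hVe
    have h3 : ‖e‖ * ‖e‖ ≤ ‖e‖ ^ (1 + Q.τ) := by
      rw [← sq, ← Real.rpow_two]
      exact Real.rpow_le_rpow_of_exponent_ge_of_imp (norm_nonneg e) h1.le (by linarith [hτ.2])
        fun _ h0 => by linarith [hτ.1]
    have h4 : ‖F v‖ ^ (1 + Q.τ) ≤ L ^ (1 + Q.τ) * ‖e‖ ^ (1 + Q.τ) := by
      rw [← Real.mul_rpow hL.le (norm_nonneg e)]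
      exact Real.rpow_le_rpow (norm_nonneg _) hFv (by linarith [hτ.1])
    have h5 : Q.υ₁ * ‖F v‖ * ‖e‖ ≤ Q.υ₁ * L * ‖e‖ ^ (1 + Q.τ) := calc
      _ ≤ Q.υ₁ * (L * ‖e‖) * ‖e‖ := by gcongr
      _ = Q.υ₁ * L * (‖e‖ * ‖e‖) := by ring
      _ ≤ _ := by gcongr
    rw [hC, div_mul_eq_mul_div, le_div_iff₀ hκ]
    linarith
  have hvd : v + d - x = e + d := by rw [he]; abel
  rw [hvd]
  refine ⟨hstep, ?_⟩
  have hpow : C * ‖e‖ ^ (1 + Q.τ) = C * ‖e‖ ^ Q.τ * ‖e‖ := by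
    rw [Real.rpow_add_of_nonneg (norm_nonneg e) zero_le_one hτ.1.le, Real.rpow_one]; ring
  rw [hpow] at hstep
  set q := C * ‖e‖ ^ Q.τ with hqdef
  have hq0 : 0 ≤ q := by positivity
  -- The value at the trial point, from above.
  have hupper : ψ (v + d) ≤ ψ x + L * ‖e + d‖ ^ 2 := by
    have := le_add_inner_add_sq h.subgradient h.lipschitz x (v + d)
    rwa [hFx, inner_zero_left, add_zero, hvd] at this
  -- The exact value at the current point.
  have hvalue : ψ v = ψ x + 1 / 2 * inner ℝ (F v) e := by
    have := eq_add_half_inner_of_homogeneous h.hasGradientAt (x := x) (h := e) (g := F v)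
      fun s hs => by rw [hseg V hV s hs, hFx, zero_add, hVe]
    rwa [he, add_sub_cancel] at this
  have hcoerce : κ * ‖e‖ ^ 2 ≤ inner ℝ (F v) e := hVe ▸ hcoer V hV e
  have hinner : inner ℝ (F v) d = inner ℝ (F v) (e + d) - inner ℝ (F v) e := by
    rw [inner_add_right, add_sub_cancel_left]
  have hlower : -(L * ‖e‖ * (q * ‖e‖)) ≤ inner ℝ (F v) (e + d) := by
    have h2 := (abs_le.1 (abs_real_inner_le_norm (F v) (e + d))).1
    have h3 : ‖F v‖ * ‖e + d‖ ≤ L * ‖e‖ * (q * ‖e‖) := by gcongr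
    linarith
  rw [lt_div_iff₀ (by positivity)] at hq2
  have hϑ0 := Q.ϑ_mem.1
  have hϑ1 : 0 < 1 / 2 - Q.ϑ := by linarith [Q.ϑ_mem.2]
  have hA : L * ‖e + d‖ ^ 2 ≤ L * q * ‖e‖ ^ 2 := calc
    L * ‖e + d‖ ^ 2 ≤ L * (q * ‖e‖) ^ 2 := by gcongr
    _ = L * (q * q) * ‖e‖ ^ 2 := by ring
    _ ≤ L * (q * 1) * ‖e‖ ^ 2 := by gcongr
    _ = L * q * ‖e‖ ^ 2 := by ring
  have hB : -(L * q * ‖e‖ ^ 2) ≤ Q.ϑ * inner ℝ (F v) (e + d) := by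
    have h2 : Q.ϑ * (L * q * ‖e‖ ^ 2) ≤ 1 * (L * q * ‖e‖ ^ 2) := by
      gcongr
      linarith
    have h3 := mul_le_mul_of_nonneg_left hlower hϑ0.le
    linarith
  have hD : 2 * (L * q * ‖e‖ ^ 2) ≤ (1 / 2 - Q.ϑ) * inner ℝ (F v) e := calc
    2 * (L * q * ‖e‖ ^ 2) = q * (2 * L) * ‖e‖ ^ 2 := by ring
    _ ≤ (1 / 2 - Q.ϑ) * κ * ‖e‖ ^ 2 := by gcongr
    _ = (1 / 2 - Q.ϑ) * (κ * ‖e‖ ^ 2) := by ring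
    _ ≤ _ := by gcongr
  change ψ (v + Q.ϱ ^ 0 • d) ≤ ψ v + Q.ϑ * Q.ϱ ^ 0 * inner ℝ (F v) d
  rw [pow_zero, one_smul, mul_one, hvalue, hinner]
  linarith

/-- An accumulation point at which the model is valid is a critical point, and the whole sequence
converges to it superlinearly, of order `1 + τ`. -/
theorem convergence (h : IsNewtonModel ψ F J x L κ Λ) (hu : IsNewtonSequence Q ψ F J u)
    (hx : MapClusterPt x atTop u) :
    Tendsto u atTop (𝓝 x) ∧
    (fun j => u (j + 1) - x) =o[atTop] (fun j => u j - x) ∧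
    (fun j => ‖u (j + 1) - x‖) =O[atTop] (fun j => ‖u j - x‖ ^ (1 + Q.τ)) := by
  have hFx := h.gradient_eq_zero hu hx
  have hτ := Q.τ_mem
  obtain ⟨C, hC⟩ := h.eventually_full_step (Q := Q) hFx
  have hnext : ∀ᶠ v in 𝓝 x, ∀ j, u j = v → ‖u (j + 1) - x‖ ≤ C * ‖u j - x‖ ^ (1 + Q.τ) := by
    filter_upwards [hC] with v hv j hj
    obtain ⟨V, hV, d, hd, c, hc, hj'⟩ := hu j
    rw [hj] at hV hd hc
    obtain ⟨h1, h2⟩ := hv V hV d hd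
    have h3 : c = 0 := Nat.le_zero.1 (hc.2 h2)
    rw [hj', h3, pow_zero, one_smul, hj]
    exact h1
  have hq : Tendsto (fun v => C * ‖v - x‖ ^ Q.τ) (𝓝 x) (𝓝 0) := by
    have h1 : Tendsto (fun v => ‖v - x‖) (𝓝 x) (𝓝 0) := by
      simpa using (continuous_id.sub continuous_const).norm.tendsto x (f := fun v : E => ‖v - x‖)
    have := (h1.rpow_const (Or.inr hτ.1.le)).const_mul C
    simpa [Real.zero_rpow hτ.1.ne'] using this
  have hpow : ∀ v : E, C * ‖v - x‖ ^ (1 + Q.τ) = C * ‖v - x‖ ^ Q.τ * ‖v - x‖ := by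
    intro v
    rw [Real.rpow_add_of_nonneg (norm_nonneg _) zero_le_one hτ.1.le, Real.rpow_one]; ring
  obtain ⟨r, hr, hball⟩ := Metric.eventually_nhds_iff_ball.1
    (hnext.and (hq.eventually_lt_const (show (0 : ℝ) < 1 / 2 by norm_num)))
  obtain ⟨j₀, hj₀⟩ := (hx.frequently (Metric.ball_mem_nhds x hr)).exists
  have hdecay : ∀ k, ‖u (j₀ + k) - x‖ ≤ (1 / 2) ^ k * ‖u j₀ - x‖ := by
    intro k
    induction k with
    | zero => simp
    | succ k ih =>
      have hk : u (j₀ + k) ∈ Metric.ball x r := by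
        rw [dist_eq_norm] at hj₀
        rw [mem_ball_iff_norm]
        refine (ih.trans (mul_le_of_le_one_left (norm_nonneg _) ?_)).trans_lt hj₀
        exact pow_le_one₀ (by norm_num) (by norm_num)
      obtain ⟨h1, h2⟩ := hball _ hk
      have h3 := h1 (j₀ + k) rfl
      rw [hpow] at h3
      calc ‖u (j₀ + (k + 1)) - x‖ ≤ C * ‖u (j₀ + k) - x‖ ^ Q.τ * ‖u (j₀ + k) - x‖ := h3
        _ ≤ 1 / 2 * ((1 / 2) ^ k * ‖u j₀ - x‖) := by gcongr
        _ = (1 / 2) ^ (k + 1) * ‖u j₀ - x‖ := by ring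
  have hlim : Tendsto u atTop (𝓝 x) := by
    rw [← tendsto_add_atTop_iff_nat j₀, tendsto_iff_norm_sub_tendsto_zero]
    have := (tendsto_pow_atTop_nhds_zero_of_lt_one (r := (1 / 2 : ℝ)) (by norm_num)
      (by norm_num)).mul_const ‖u j₀ - x‖
    rw [zero_mul] at this
    exact squeeze_zero (fun _ => norm_nonneg _) (fun k => add_comm j₀ k ▸ hdecay k) this
  have hstep : ∀ᶠ j in atTop, ‖u (j + 1) - x‖ ≤ C * ‖u j - x‖ ^ (1 + Q.τ) :=
    (hlim.eventually hnext).mono fun j hj => hj j rfl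
  refine ⟨hlim, ?_, ?_⟩
  · refine Asymptotics.isLittleO_iff.2 fun c hc => ?_
    filter_upwards [hstep, (hq.comp hlim).eventually_lt_const hc] with j hj hj'
    rw [hpow] at hj
    exact hj.trans (by gcongr; exact hj'.le)
  · refine Asymptotics.IsBigO.of_bound C ?_
    filter_upwards [hstep] with j hj
    rwa [norm_norm, Real.norm_of_nonneg (Real.rpow_nonneg (norm_nonneg _) _)]

end IsNewtonModel

end Convergence

/-! ### The dual subproblem -/

namespace Subproblem

variable {m N : ℕ} (P : Subproblem m N)

/-- The gradient `A Π_C(ẑ(u)) - Prox(z̃(u)) - ε e` of the dual objective function. -/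
def grad (u : EuclideanSpace ℝ (Fin N)) : EuclideanSpace ℝ (Fin N) :=
  P.A (proj P.C (P.zHat u)) - prox Set.univ P.scaledL1 (P.zTilde u) - P.ε • ones N

/-- The generalized Hessians `σ A H Aᵀ + γ U` of the dual objective function. -/
def hessian (u : EuclideanSpace ℝ (Fin N)) :
    Set (EuclideanSpace ℝ (Fin N) →L[ℝ] EuclideanSpace ℝ (Fin N)) :=
  {V | ∃ H ∈ P.hsJacobianC (P.zHat u),
    ∃ U ∈ clarkeJacobian (prox Set.univ P.scaledL1) (P.zTilde u),
    V = P.σ • (P.A ∘L H ∘L P.At) + P.γ • U}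

theorem inner_At (u : EuclideanSpace ℝ (Fin N)) (x : EuclideanSpace ℝ (Fin m)) :
    inner ℝ (P.At u) x = inner ℝ u (P.A x) := by
  have h := Matrix.toEuclideanLin_conjTranspose_eq_adjoint P.matA
  rw [Matrix.conjTranspose_eq_transpose_of_trivial] at h
  change inner ℝ (Matrix.toEuclideanLin P.matA.transpose u) x
    = inner ℝ u (Matrix.toEuclideanLin P.matA x)
  rw [h, LinearMap.adjoint_inner_left]

theorem zHat_add_smul (x u : EuclideanSpace ℝ (Fin N)) (s : ℝ) :
    P.zHat (x + s • (u - x)) = P.zHat x + s • (P.zHat u - P.zHat x) := by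
  simp only [zHat, map_add, map_smul, map_sub]
  module

theorem zHat_sub (u v : EuclideanSpace ℝ (Fin N)) :
    P.zHat u - P.zHat v = P.σ • P.At (u - v) := by
  simp only [zHat, map_sub]
  module

theorem zTilde_add_smul (x u : EuclideanSpace ℝ (Fin N)) (s : ℝ) :
    P.zTilde (x + s • (u - x)) = P.zTilde x + s • (P.zTilde u - P.zTilde x) := by
  simp only [zTilde]
  module

theorem zTilde_sub (u v : EuclideanSpace ℝ (Fin N)) :
    P.zTilde u - P.zTilde v = -(P.γ • (u - v)) := by
  simp only [zTilde]
  module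

theorem continuous_zHat : Continuous P.zHat :=
  continuous_const.add (P.At.continuous.const_smul P.σ)

theorem continuous_zTilde : Continuous P.zTilde :=
  continuous_const.sub ((continuous_const.add continuous_id).const_smul P.γ)

theorem threshold_nonneg : 0 ≤ P.γ / (2 * (N : ℝ)) :=
  div_nonneg P.γ_pos.le (by positivity)

theorem threshold_pos (hN : 0 < N) : 0 < P.γ / (2 * (N : ℝ)) :=
  div_pos P.γ_pos (by positivity)

theorem isProxPoint_C (hC : P.C.Nonempty) (z : EuclideanSpace ℝ (Fin m)) :
    IsProxPoint P.C (fun _ => 0) z (proj P.C z) := by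
  rw [C_eq_polyhedron] at hC ⊢
  exact isProxPoint_polyhedron hC z

theorem isProxPoint_scaledL1 (z : EuclideanSpace ℝ (Fin N)) :
    IsProxPoint Set.univ P.scaledL1 z (prox Set.univ P.scaledL1 z) := by
  have h : IsProxPoint Set.univ P.scaledL1 z _ := isProxPoint_l1norm P.threshold_nonneg z
  rwa [h.prox_eq]

theorem ψ_add_inner_grad_le (hC : P.C.Nonempty) (u v : EuclideanSpace ℝ (Fin N)) :
    P.ψ u + inner ℝ (P.grad u) (v - u) ≤ P.ψ v := by
  have hσ := P.σ_pos
  have hγ := P.γ_pos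
  have e₁ : ∀ z, moreauEnvelope P.C (fun _ => 0) P.σ z
      = 1 / (2 * P.σ) * ‖proj P.C z - z‖ ^ 2 := fun z => by
    have h := IsProxPoint.moreauEnvelope_eq (f := fun _ => 0) hσ
      (by simpa using P.isProxPoint_C hC z)
    simpa using h
  have e₂ : ∀ z, moreauEnvelope Set.univ P.scaledL1 1 z = P.scaledL1 (prox Set.univ P.scaledL1 z)
      + 1 / 2 * ‖prox Set.univ P.scaledL1 z - z‖ ^ 2 := fun z => by
    have h := IsProxPoint.moreauEnvelope_eq (f := P.scaledL1) one_pos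
      (by simpa using P.isProxPoint_scaledL1 z)
    simpa using h
  have h₁ := (P.isProxPoint_C hC (P.zHat u)).subgradient (P.isProxPoint_C hC (P.zHat v))
  have h₂ := (P.isProxPoint_scaledL1 (P.zTilde u)).subgradient (P.isProxPoint_scaledL1 (P.zTilde v))
  rw [zHat_sub, inner_smul_right, real_inner_comm, inner_At, real_inner_comm] at h₁
  rw [zTilde_sub, inner_neg_right, inner_smul_right] at h₂
  have h₁' := mul_le_mul_of_nonneg_left h₁ (one_div_pos.2 hσ).le
  have h₂' := mul_le_mul_of_nonneg_left h₂ (one_div_pos.2 hγ).le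
  have c₁ : ∀ a b c : ℝ, 1 / P.σ * (1 / 2 * a - (0 + 1 / 2 * b) + P.σ * c)
      = 1 / (2 * P.σ) * a - 1 / (2 * P.σ) * b + c := fun a b c => by field_simp; ring
  have c₁' : ∀ a b : ℝ, 1 / P.σ * (1 / 2 * a - (0 + 1 / 2 * b))
      = 1 / (2 * P.σ) * a - 1 / (2 * P.σ) * b := fun a b => by field_simp; ring
  have c₂ : ∀ a b c : ℝ, 1 / P.γ * (1 / 2 * a - b + -(P.γ * c))
      = 1 / (2 * P.γ) * a - 1 / P.γ * b - c := fun a b c => by field_simp; ring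
  have c₂' : ∀ a b : ℝ, 1 / P.γ * (1 / 2 * a - b)
      = 1 / (2 * P.γ) * a - 1 / P.γ * b := fun a b => by field_simp
  rw [c₁, c₁'] at h₁'
  rw [c₂, c₂'] at h₂'
  have h₃ : inner ℝ (P.grad u) (v - u) = inner ℝ (P.A (proj P.C (P.zHat u))) (v - u)
      - inner ℝ (prox Set.univ P.scaledL1 (P.zTilde u)) (v - u)
      - P.ε * (inner ℝ v (ones N) - inner ℝ u (ones N)) := by
    rw [grad, inner_sub_left, inner_sub_left, real_inner_smul_left, inner_sub_right (ones N),
      real_inner_comm v (ones N), real_inner_comm u (ones N)]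
  simp only [ψ, e₁, e₂]
  rw [h₃]
  linarith

theorem norm_grad_sub_le (hC : P.C.Nonempty) (u v : EuclideanSpace ℝ (Fin N)) :
    ‖P.grad u - P.grad v‖ ≤ (‖P.A‖ * (P.σ * ‖P.At‖) + P.γ) * ‖u - v‖ := by
  have h₁ := (P.isProxPoint_C hC (P.zHat u)).norm_sub_le (P.isProxPoint_C hC (P.zHat v))
  have h₂ := (P.isProxPoint_scaledL1 (P.zTilde u)).norm_sub_le
    (P.isProxPoint_scaledL1 (P.zTilde v))
  rw [zHat_sub, norm_smul, Real.norm_of_nonneg P.σ_pos.le] at h₁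
  rw [zTilde_sub, norm_neg, norm_smul, Real.norm_of_nonneg P.γ_pos.le] at h₂
  have e : P.grad u - P.grad v = P.A (proj P.C (P.zHat u) - proj P.C (P.zHat v))
      - (prox Set.univ P.scaledL1 (P.zTilde u) - prox Set.univ P.scaledL1 (P.zTilde v)) := by
    simp only [grad, map_sub]; abel
  have h₃ : ‖P.A (proj P.C (P.zHat u) - proj P.C (P.zHat v))‖
      ≤ ‖P.A‖ * (P.σ * (‖P.At‖ * ‖u - v‖)) := by
    refine (P.A.le_opNorm _).trans ?_
    have := P.At.le_opNorm (u - v)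
    have := P.σ_pos
    gcongr
    exact h₁.trans (by gcongr)
  rw [e]
  refine (norm_sub_le _ _).trans ((add_le_add h₃ h₂).trans_eq ?_)
  ring

section Hessian

variable {P} {u : EuclideanSpace ℝ (Fin N)}
  {H : EuclideanSpace ℝ (Fin m) →L[ℝ] EuclideanSpace ℝ (Fin m)}

theorem exists_eq_starProjection (hH : H ∈ P.hsJacobianC (P.zHat u)) :
    ∃ S : Submodule ℝ (EuclideanSpace ℝ (Fin m)), H = S.starProjection := by
  obtain ⟨K, -, rfl⟩ := hH
  exact ⟨_, rfl⟩

theorem inner_hessian_starProjection (S : Submodule ℝ (EuclideanSpace ℝ (Fin m)))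
    (U : EuclideanSpace ℝ (Fin N) →L[ℝ] EuclideanSpace ℝ (Fin N))
    (v w : EuclideanSpace ℝ (Fin N)) :
    inner ℝ ((P.σ • (P.A ∘L S.starProjection ∘L P.At) + P.γ • U) v) w
      = P.σ * inner ℝ (S.starProjection (P.At v)) (S.starProjection (P.At w))
        + P.γ * inner ℝ (U v) w := by
  have e : (P.σ • (P.A ∘L S.starProjection ∘L P.At) + P.γ • U) v
      = P.σ • P.A (S.starProjection (P.At v)) + P.γ • U v := rfl
  have h : S.starProjection (S.starProjection (P.At v)) = S.starProjection (P.At v) :=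
    Submodule.starProjection_eq_self_iff.2 (S.starProjection_apply_mem _)
  rw [e, inner_add_left, real_inner_smul_left, real_inner_smul_left, real_inner_comm w, ← inner_At,
    ← S.inner_starProjection_left_eq_right (S.starProjection (P.At v)), h,
    real_inner_comm (S.starProjection (P.At v))]

theorem isSoftJacobian_of_mem {y : EuclideanSpace ℝ (Fin N)}
    {U : EuclideanSpace ℝ (Fin N) →L[ℝ] EuclideanSpace ℝ (Fin N)}
    (hU : U ∈ clarkeJacobian (prox Set.univ P.scaledL1) y) :
    IsSoftJacobian (P.γ / (2 * (N : ℝ))) y U :=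
  isSoftJacobian_of_mem_clarkeJacobian P.threshold_nonneg hU

theorem hessian_symmetric {V : EuclideanSpace ℝ (Fin N) →L[ℝ] EuclideanSpace ℝ (Fin N)}
    (hV : V ∈ P.hessian u) (v w : EuclideanSpace ℝ (Fin N)) :
    inner ℝ (V v) w = inner ℝ v (V w) := by
  obtain ⟨H, hH, U, hU, rfl⟩ := hV
  obtain ⟨S, rfl⟩ := exists_eq_starProjection hH
  rw [real_inner_comm _ v, inner_hessian_starProjection, inner_hessian_starProjection,
    (isSoftJacobian_of_mem hU).inner_comm v w, real_inner_comm v,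
    real_inner_comm (S.starProjection (P.At v))]

theorem hessian_nonneg {V : EuclideanSpace ℝ (Fin N) →L[ℝ] EuclideanSpace ℝ (Fin N)}
    (hV : V ∈ P.hessian u) (w : EuclideanSpace ℝ (Fin N)) : 0 ≤ inner ℝ (V w) w := by
  obtain ⟨H, hH, U, hU, rfl⟩ := hV
  obtain ⟨S, rfl⟩ := exists_eq_starProjection hH
  rw [inner_hessian_starProjection]
  exact add_nonneg (mul_nonneg P.σ_pos.le real_inner_self_nonneg)
    (mul_nonneg P.γ_pos.le ((isSoftJacobian_of_mem hU).inner_nonneg w))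

theorem norm_hessian_apply_le {V : EuclideanSpace ℝ (Fin N) →L[ℝ] EuclideanSpace ℝ (Fin N)}
    (hV : V ∈ P.hessian u) (w : EuclideanSpace ℝ (Fin N)) :
    ‖V w‖ ≤ (P.σ * (‖P.A‖ * ‖P.At‖) + P.γ) * ‖w‖ := by
  obtain ⟨H, hH, U, hU, rfl⟩ := hV
  obtain ⟨S, rfl⟩ := exists_eq_starProjection hH
  have e : (P.σ • (P.A ∘L S.starProjection ∘L P.At) + P.γ • U) w
      = P.σ • P.A (S.starProjection (P.At w)) + P.γ • U w := rfl
  have h₁ : ‖P.A (S.starProjection (P.At w))‖ ≤ ‖P.A‖ * (‖P.At‖ * ‖w‖) :=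
    (P.A.le_opNorm _).trans
      (by gcongr; exact (S.norm_starProjection_apply_le _).trans (P.At.le_opNorm _))
  have h₂ := (isSoftJacobian_of_mem hU).norm_le w
  have hσ := P.σ_pos
  have hγ := P.γ_pos
  rw [e]
  calc _ ≤ ‖P.σ • P.A (S.starProjection (P.At w))‖ + ‖P.γ • U w‖ := norm_add_le _ _
    _ ≤ P.σ * (‖P.A‖ * (‖P.At‖ * ‖w‖)) + P.γ * ‖w‖ := by
      rw [norm_smul, norm_smul, Real.norm_of_nonneg hσ.le, Real.norm_of_nonneg hγ.le]
      gcongr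
    _ = _ := by ring

end Hessian

theorem eventually_proj_segment (hC : P.C.Nonempty) (x : EuclideanSpace ℝ (Fin N)) :
    ∀ᶠ u in 𝓝 x, ∀ H ∈ P.hsJacobianC (P.zHat u),
      (∃ S : Submodule ℝ (EuclideanSpace ℝ (Fin m)),
        linearitySpace (posTangentConeAt P.C (proj P.C (P.zHat x))) ⊆ S ∧ H = S.starProjection) ∧
      ∀ s ∈ Set.Icc (0 : ℝ) 1, proj P.C (P.zHat x + s • (P.zHat u - P.zHat x)) =
        proj P.C (P.zHat x) + s • H (P.zHat u - P.zHat x) := by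
  rw [C_eq_polyhedron] at hC ⊢
  filter_upwards [P.continuous_zHat.continuousAt.eventually
    (eventually_proj_polyhedron_segment hC (P.zHat x))] with u hu H hH
  obtain ⟨⟨K, hK, h⟩, hseg⟩ := hu H hH
  exact ⟨⟨_, linearitySpace_subset_orthogonal (isProxPoint_polyhedron hC _).1 hK, h⟩, hseg⟩

/-- Under constraint nondegeneracy, all that the convergence of the semismooth Newton method
requires holds for the dual subproblem. -/
theorem isNewtonModel (hN : 0 < N) (hC : P.C.Nonempty) {x : EuclideanSpace ℝ (Fin N)}
    (hnd : P.ConstraintNondegenerate (proj P.C (P.zHat x))) :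
    ∃ L κ Λ, IsNewtonModel P.ψ P.grad P.hessian x L κ Λ := by
  have hσ := P.σ_pos
  have hγ := P.γ_pos
  obtain ⟨c, hc, hcS⟩ := exists_pos_le_norm_starProjection (fun x y => P.inner_At y x) hnd
  have hproj := P.eventually_proj_segment hC x
  refine ⟨‖P.A‖ * (P.σ * ‖P.At‖) + P.γ, P.σ * c, P.σ * (‖P.A‖ * ‖P.At‖) + P.γ, ?_⟩
  refine ⟨by positivity, by positivity, by positivity, P.ψ_add_inner_grad_le hC,
    P.norm_grad_sub_le hC, fun u V hV => hessian_symmetric hV, fun u V hV => hessian_nonneg hV,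
    ?_, Eventually.of_forall fun u V hV => norm_hessian_apply_le hV, ?_⟩
  · filter_upwards [hproj] with u hu V hV w
    obtain ⟨H, hH, U, hU, rfl⟩ := hV
    obtain ⟨⟨S, hS, rfl⟩, -⟩ := hu H hH
    rw [inner_hessian_starProjection, real_inner_self_eq_norm_sq, mul_assoc]
    have h₁ := mul_le_mul_of_nonneg_left (hcS S hS w) hσ.le
    have h₂ := mul_nonneg hγ.le ((isSoftJacobian_of_mem hU).inner_nonneg w)
    linarith
  · filter_upwards [hproj, P.continuous_zTilde.continuousAt.eventually
      (eventually_prox_l1norm_segment (P.threshold_pos hN) (P.zTilde x))] with u hu hu' V hV s hs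
    obtain ⟨H, hH, U, hU, rfl⟩ := hV
    have h₁ := (hu H hH).2 s hs
    have h₂ : prox Set.univ P.scaledL1 (P.zTilde x + s • (P.zTilde u - P.zTilde x)) =
        prox Set.univ P.scaledL1 (P.zTilde x) + s • U (P.zTilde u - P.zTilde x) :=
      hu' U (isSoftJacobian_of_mem hU) s hs
    have e : (P.σ • (P.A ∘L H ∘L P.At) + P.γ • U) (u - x)
        = P.σ • P.A (H (P.At (u - x))) + P.γ • U (u - x) := rfl
    rw [grad, zHat_add_smul, zTilde_add_smul, h₁, h₂, zHat_sub, zTilde_sub, e, grad]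
    simp only [map_add, map_smul, map_neg]
    module

/-- Under constraint nondegeneracy, a critical point is the only one: at two critical points the
projections `Π_C(ẑ)` agree by monotonicity, so that the difference of the two vectors `ẑ` is
orthogonal to the linearity space of the tangent cone. -/
theorem eq_of_grad_eq_zero (hC : P.C.Nonempty) {x v : EuclideanSpace ℝ (Fin N)}
    (hnd : P.ConstraintNondegenerate (proj P.C (P.zHat x)))
    (hx : P.grad x = 0) (hv : P.grad v = 0) : v = x := by
  have hσ := P.σ_pos
  have hγ := P.γ_pos
  have hpv := P.isProxPoint_C hC (P.zHat v)
  have hpx := P.isProxPoint_C hC (P.zHat x)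
  have h₁ := hpv.norm_sub_sq_le hpx
  have h₂ := (P.isProxPoint_scaledL1 (P.zTilde v)).norm_sub_sq_le
    (P.isProxPoint_scaledL1 (P.zTilde x))
  rw [zHat_sub, inner_smul_right, real_inner_comm, inner_At, real_inner_comm] at h₁
  rw [zTilde_sub, inner_neg_right, inner_smul_right] at h₂
  have h₃ : P.A (proj P.C (P.zHat v) - proj P.C (P.zHat x))
      = prox Set.univ P.scaledL1 (P.zTilde v) - prox Set.univ P.scaledL1 (P.zTilde x) := by
    have h : P.grad v - P.grad x = 0 := by rw [hx, hv, sub_zero]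
    rw [← sub_eq_zero, ← h]
    simp only [grad, map_sub]
    abel
  have hproj : proj P.C (P.zHat v) = proj P.C (P.zHat x) := by
    rw [h₃] at h₁
    have h₄ : inner ℝ (prox Set.univ P.scaledL1 (P.zTilde v)
        - prox Set.univ P.scaledL1 (P.zTilde x)) (v - x) ≤ 0 := by
      refine nonpos_of_mul_nonpos_right (a := P.γ) ?_ hγ
      linarith [sq_nonneg ‖prox Set.univ P.scaledL1 (P.zTilde v)
        - prox Set.univ P.scaledL1 (P.zTilde x)‖]
    have h₅ := mul_nonpos_of_nonneg_of_nonpos hσ.le h₄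
    have h₆ := pow_eq_zero_iff two_ne_zero |>.1 (le_antisymm (h₁.trans h₅) (sq_nonneg _))
    exact sub_eq_zero.1 (norm_eq_zero.1 h₆)
  rw [hproj] at hpv
  obtain ⟨d, hd, hAd⟩ : v - x ∈ P.A '' _ := hnd ▸ Set.mem_univ (v - x)
  have hnormal : ∀ {z}, IsProxPoint P.C (fun _ => 0) z (proj P.C (P.zHat x)) →
      inner ℝ (z - proj P.C (P.zHat x)) d = 0 := fun {z} hz => by
    have h := inner_eq_zero_of_mem_linearitySpace (g := -(z - proj P.C (P.zHat x)))
      (fun w hw => by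
        have := hz.2 w hw
        rw [inner_sub_right] at this
        rw [inner_neg_left, inner_neg_left]
        linarith) hd
    rwa [inner_neg_left, neg_eq_zero] at h
  have h₇ : inner ℝ (P.zHat v - P.zHat x) d = 0 := by
    rw [← sub_sub_sub_cancel_right _ _ (proj P.C (P.zHat x)), inner_sub_left, hnormal hpv,
      hnormal hpx, sub_zero]
  rw [zHat_sub, real_inner_smul_left, inner_At, hAd] at h₇
  exact sub_eq_zero.1 (inner_self_eq_zero.1 ((mul_eq_zero.1 h₇).resolve_left hσ.ne'))

end Subproblem

end SSN

end

theorem theorem4p3 {m N : ℕ} (hN : 0 < N) (P : SSN.Subproblem m N) (hC : P.C.Nonempty)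
    (Q : SSN.Params) (u : ℕ → EuclideanSpace ℝ (Fin N)) (hu : SSN.IsSSNSequence P Q u)
    (ustar : EuclideanSpace ℝ (Fin N)) (hacc : MapClusterPt ustar Filter.atTop u)
    (hnd : P.ConstraintNondegenerate (SSN.proj P.C (P.xk + P.σ • P.At ustar))) :
    (∀ v, IsMinOn P.ψ Set.univ v ↔ v = ustar) ∧
    Filter.Tendsto u Filter.atTop (nhds ustar) ∧
    (fun j => u (j + 1) - ustar) =o[Filter.atTop] (fun j => u j - ustar) ∧
    (fun j => ‖u (j + 1) - ustar‖) =O[Filter.atTop] (fun j => ‖u j - ustar‖ ^ (1 + Q.τ)) := by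
  obtain ⟨L, κ, Λ, hmodel⟩ := P.isNewtonModel hN hC (x := ustar) hnd
  have hgrad : gradient P.ψ = P.grad := gradient_eq hmodel.hasGradientAt
  have hseq : SSN.IsNewtonSequence Q P.ψ P.grad P.hessian u := by
    intro j
    obtain ⟨d, ⟨H, hH, U, hU, M, rfl, hd⟩, c, hc, hj⟩ := hu j
    rw [SSN.IsArmijoExponent, hgrad] at hc
    rw [hgrad] at hd
    exact ⟨_, ⟨H, hH, U, hU, rfl⟩, d, hd, c, hc, hj⟩
  have hzero := hmodel.gradient_eq_zero hseq hacc
  refine ⟨fun v => ⟨fun hv => ?_, ?_⟩, hmodel.convergence hseq hacc⟩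
  · refine P.eq_of_grad_eq_zero hC hnd hzero ?_
    have h : IsLocalMin P.ψ v := Filter.Eventually.of_forall fun w => hv (Set.mem_univ w)
    simpa using h.hasFDerivAt_eq_zero (hmodel.hasGradientAt v).hasFDerivAt
  · rintro rfl w -
    simpa [hzero] using hmodel.subgradient v w
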